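/- Let $G$ be a countable discrete group and let $\mathcal F(G)$ be the collection of its nonempty finite subsets, on which $G$ acts by $g\cdot F = Fg^{-1}$. For $K\in\mathcal F(G)$ and $\delta>0$, a set $F\in\mathcal F(G)$ is $(K,\delta)$-invariant if $|KF\,\triangle\,F|\le\delta|F|$. Assume that $G$ is amenable, i.e. that for every $(K,\delta)$ there is a $(K,\delta)$-invariant set. For $f:\mathcal F(G)\to[0,\infty]$ put $\limsup_{F\to G}f(F)=\inf_{(K,\delta)}\sup\{f(F): F \text{ is }(K,\delta)\text{-invariant}\}$. Given a real semi-normed space $(V,\|\cdot\|)$ and a uniformly bounded representation $\pi$ of $G$ by bounded invertible linear operators on $V$ (i.e. $\sup_g\|\pi(g)\|_{\mathrm{op}}<\infty$), let $\mathcal M$ be the set of maps $\varphi:\mathcal F(G)\to V$ that are bounded ($\sup_F\|\varphi(F)/|F|\|<\infty$) and $G$-equivariant ($\pi(g)\varphi(F)=\varphi(g\cdot F)$). Let $\mathcal N\subseteq\mathcal M$ consist of those $\varphi$ with $\limsup_{F\to G}\|\varphi(F)/|F|\|=0$, and let $\mathcal M_\oplus\subseteq\mathcal M$ consist of the additive ones,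 i.e. $\varphi(E\sqcup F)=\varphi(E)+\varphi(F)$ for disjoint $E,F$. Let $\mathcal N_{\mathbb R}$ be $\mathcal N$ for the trivial representation of $G$ on $\mathbb R$. A partition $\mathcal P$ of $F\in\mathcal F(G)$ is monotone invariant if, for all $(K,\delta)$ and all $E\in\mathcal P$, $F$ is $(K,\delta)$-invariant whenever $E$ is. A map $\varphi\in\mathcal M$ is * asymptotically additive if $\inf_{\psi\in\mathcal M_\oplus}\limsup_{F\to G}\|(\varphi(F)-\psi(F))/|F|\|=0$; * almost additive if there is $b\in\mathcal N_{\mathbb R}$ with $\|\varphi(F)-\sum_{E\in\mathcal P}\varphi(E)\|\le\sum_{E\in\mathcal P}b(E)$ for every $F\in\mathcal F(G)$ and every monotone invariant partition $\mathcal P$ of $F$; * Riesz-almost additive (when $V$ is a semi-normed Riesz space) if there is $\xi\in\mathcal N$ with $|\varphi(F)-\sum_{E\in\mathcal P}\varphi(E)|\le\sum_{E\in\mathcal P}\xi(E)$, in the order of $V$, for all such $F$ and $\mathcal P$; of constant type (when $V$ consists of bounded functions) if moreover $\xi(F)=c(F)\mathbf 1$ for some $c:\mathcal F(G)\to\mathbb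 R$. A semi-normed Riesz space is a real vector lattice with a semi-norm such that $|u|\le|v|$ implies $\|u\|\le\|v\|$. Then: 1. If $V$ is a complete semi-normed space, $\pi$ is uniformly bounded and $\varphi\in\mathcal M$ is asymptotically additive, then $\varphi$ is almost additive. If $G$ is residually finite, then conversely every almost additive $\varphi\in\mathcal M$ is asymptotically additive. 2. If $V$ is a complete semi-normed Riesz space, $\pi$ is uniformly bounded and $\varphi\in\mathcal M$ is Riesz-almost additive, then $\varphi$ is almost additive. 3. The converse of 2 fails in general: if $G$ is infinite, then for the trivial representation of $G$ on $V=L^1([0,1],\mathbb R)$ there is $\varphi\in\mathcal M$ that is almost additive but not Riesz-almost additive. 4. The converse of 2 holds for bounded functions and unital representations: if $V$ is the Banach lattice of bounded real-valued functions on a set $X$ with the supremum norm and the pointwise order, and $\pi$ is uniformly bounded with $\pi(g)\mathbf 1=\mathbf 1$ for all $g\in G$, then for every $\varphi\in\mathcal M$ the following are equivalent: $\varphi$ is almost additive; $\varphi$ is Riesz-almost additive of constant type; $\varphi$ is Riesz-almost additive. -/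

import Mathlib

open scoped ENNReal Pointwise symmDiff BoundedContinuousFunction

namespace SetMap

universe u v

/-- The collection of nonempty finite subsets of `G`. -/
abbrev FinSets (G : Type u) : Type u := {F : Finset G // F.Nonempty}

section Group

variable {G : Type u} [Group G]

/-- The left action of `G` on nonempty finite subsets, `g · F = F g⁻¹`. -/
def gact (g : G) (F : FinSets G) : FinSets G :=
  ⟨F.1.map (Equiv.mulRight g⁻¹).toEmbedding, F.2.map⟩

open Classical in
/-- `F` is `(K, δ)`-invariant: `|K F ∆ F| ≤ δ |F|`. -/
def IsAlmostInvariant (K : FinSets G) (δ : ℝ) (F : FinSets G) : Prop :=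
  (((K.1 * F.1) ∆ F.1).card : ℝ) ≤ δ * (F.1.card : ℝ)

variable (G) in
/-- Amenability of a (countable) discrete group: for every `(K, δ)` there is a
`(K, δ)`-invariant nonempty finite set. -/
def IsAmenable : Prop :=
  ∀ (K : FinSets G) (δ : ℝ), 0 < δ → ∃ F : FinSets G, IsAlmostInvariant K δ F

/-- The limit superior of a (nonnegative) set map as `F` becomes more and more invariant:
the infimum over `(K, δ)` of the supremum over all `(K, δ)`-invariant sets. -/
noncomputable def limsupInv (f : FinSets G → ℝ≥0∞) : ℝ≥0∞ :=
  ⨅ (K : FinSets G) (δ : ℝ) (_ : 0 < δ), ⨆ (F : FinSets G) (_ : IsAlmostInvariant K δ F), f F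

/-- `P` is a partition of `F` into nonempty finite sets. -/
structure IsPartition (P : Finset (FinSets G)) (F : FinSets G) : Prop where
  disjoint : ∀ E ∈ P, ∀ E' ∈ P, E ≠ E' → Disjoint E.1 E'.1
  cover : ∀ x : G, x ∈ F.1 ↔ ∃ E ∈ P, x ∈ E.1

/-- `P` is a monotone invariant partition of `F`: it is a partition of `F`, and `F` is
`(K, δ)`-invariant as soon as one of the pieces is. -/
structure IsMonotonePartition (P : Finset (FinSets G)) (F : FinSets G) : Prop
    extends IsPartition P F where
  monotone : ∀ (K : FinSets G) (δ : ℝ), 0 < δ →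
    ∀ E ∈ P, IsAlmostInvariant K δ E → IsAlmostInvariant K δ F

section SemiNormed

variable {V : Type v} [SeminormedAddCommGroup V] [NormedSpace ℝ V]

/-- The set map `F ↦ ‖φ(F) / |F|‖`. -/
noncomputable def normalized (φ : FinSets G → V) (F : FinSets G) : ℝ≥0∞ :=
  ‖((F.1.card : ℝ)⁻¹) • φ F‖ₑ

/-- The semi-norm `sup_F ‖φ(F) / |F|‖` (possibly infinite). -/
noncomputable def supNorm (φ : FinSets G → V) : ℝ≥0∞ :=
  ⨆ F : FinSets G, normalized φ F

/-- The semi-norm `limsup_{F → G} ‖φ(F) / |F|‖` (possibly infinite). -/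
noncomputable def asympNorm (φ : FinSets G → V) : ℝ≥0∞ :=
  limsupInv (normalized φ)

/-- The representation `π` is uniformly bounded: `sup_g ‖π(g)‖ < ∞`. -/
def UniformlyBounded (π : G →* (V ≃L[ℝ] V)) : Prop :=
  ∃ C : ℝ, ∀ g : G, ‖((π g : V ≃L[ℝ] V) : V →L[ℝ] V)‖ ≤ C

/-- `G`-equivariance of a set map: `π(g) φ(F) = φ(g · F)`. -/
def Equivariant (π : G →* (V ≃L[ℝ] V)) (φ : FinSets G → V) : Prop :=
  ∀ (g : G) (F : FinSets G), π g (φ F) = φ (gact g F)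

/-- The space of bounded and `G`-equivariant set maps. -/
def maps (π : G →* (V ≃L[ℝ] V)) : Set (FinSets G → V) :=
  {φ | supNorm φ < ∞ ∧ Equivariant π φ}

/-- The asymptotical kernel: the bounded `G`-equivariant set maps `φ` with
`limsup_{F → G} ‖φ(F) / |F|‖ = 0`. -/
def asympKernel (π : G →* (V ≃L[ℝ] V)) : Set (FinSets G → V) :=
  {φ | φ ∈ maps π ∧ asympNorm φ = 0}

/-- The additive set maps among the bounded `G`-equivariant ones. -/
def additiveMaps (π : G →* (V ≃L[ℝ] V)) : Set (FinSets G → V) :=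
  {ψ | ψ ∈ maps π ∧ ∀ E F D : FinSets G, Disjoint E.1 F.1 →
    (D.1 : Set G) = (E.1 : Set G) ∪ (F.1 : Set G) → ψ D = ψ E + ψ F}

/-- Asymptotic additivity: `inf` over additive `ψ` of
`limsup_{F → G} ‖(φ(F) - ψ(F)) / |F|‖` is zero. -/
def AsymptoticallyAdditive (π : G →* (V ≃L[ℝ] V)) (φ : FinSets G → V) : Prop :=
  φ ∈ maps π ∧ (⨅ ψ ∈ additiveMaps π, asympNorm (φ - ψ)) = 0

/-- Almost additivity; the error `b` is in the asymptotical kernel of the trivial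
representation of `G` on `ℝ`. -/
def AlmostAdditive (π : G →* (V ≃L[ℝ] V)) (φ : FinSets G → V) : Prop :=
  φ ∈ maps π ∧ ∃ b ∈ asympKernel (1 : G →* (ℝ ≃L[ℝ] ℝ)),
    ∀ (F : FinSets G) (P : Finset (FinSets G)), IsMonotonePartition P F →
      ‖φ F - ∑ E ∈ P, φ E‖ ≤ ∑ E ∈ P, b E

section Riesz

variable [Lattice V]

/-- `φ` is `ξ`-Riesz-almost additive: `|φ(F) - ∑ φ(E)| ≤ ∑ ξ(E)` in the order of `V`, for every
monotone invariant partition. -/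
def RieszAlmostAdditiveWith (ξ φ : FinSets G → V) : Prop :=
  ∀ (F : FinSets G) (P : Finset (FinSets G)), IsMonotonePartition P F →
    |φ F - ∑ E ∈ P, φ E| ≤ ∑ E ∈ P, ξ E

/-- Riesz-almost additivity, with an error `ξ` in the asymptotical kernel of `π`. -/
def RieszAlmostAdditive (π : G →* (V ≃L[ℝ] V)) (φ : FinSets G → V) : Prop :=
  φ ∈ maps π ∧ ∃ ξ ∈ asympKernel π, RieszAlmostAdditiveWith ξ φ

end Riesz

end SemiNormed

section BoundedFunctions

/- For a discrete space `X`, i.e. a plain set, `X →ᵇ ℝ` is the Banach lattice of all bounded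
real-valued functions on `X` with the supremum norm and the pointwise order. -/
variable {X : Type v} [TopologicalSpace X] [DiscreteTopology X]

/-- A representation on the bounded functions is unital if it fixes the constant function `1`. -/
def Unital (π : G →* ((X →ᵇ ℝ) ≃L[ℝ] (X →ᵇ ℝ))) : Prop :=
  ∀ g : G, π g (BoundedContinuousFunction.const X (1 : ℝ)) =
    BoundedContinuousFunction.const X (1 : ℝ)

/-- Riesz-almost additivity of constant type: the error is of the form `ξ(F) = c(F) 1` for a
real-valued set map `c`. -/
def RieszAlmostAdditiveConstType (π : G →* ((X →ᵇ ℝ) ≃L[ℝ] (X →ᵇ ℝ)))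
    (φ : FinSets G → (X →ᵇ ℝ)) : Prop :=
  φ ∈ maps π ∧ ∃ ξ ∈ asympKernel π,
    (∃ c : FinSets G → ℝ, ∀ F, ξ F = c F • BoundedContinuousFunction.const X (1 : ℝ)) ∧
    RieszAlmostAdditiveWith ξ φ

end BoundedFunctions

end Group

end SetMap

/-!
The proof rests on the filter `invFilter G` of increasingly invariant sets: the limit superior along
`F → G` vanishes iff every bound `ε |F|` holds eventually along this filter.

*From asymptotic to almost additivity.* An additive map is determined by its value `v` at `{1}`, and
replacing `v` by its average over a finite set changes it by a negligible map. Hence vectors whose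
additive maps are asymptotically close can be taken close in norm, and completeness yields a single
additive `ψ` with `η = φ - ψ` negligible (`exists_addMap_sub_negligible`). A monotone invariant
partition cuts a set into pieces that are no more invariant, so bounding `‖η F‖ / |F|` by its
supremum over all sets at least as invariant as a given piece provides the error term
(`almostAdditive_of_negligible`).

*From almost to asymptotic additivity.* The key is a supply of monotone invariant partitions. A set
`E` with trivial left stabilizer is, for every `K` simultaneously, no more invariant than any `F`
that is sufficiently invariant relative to `E` (`card_mul_card_symmDiff_le`), so every partition of
such an `F` into pieces of bounded size with trivial stabilizers is monotone invariant. Removing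
intersections with translates of an invariant set one after the other cuts an invariant set into
bounded pieces most of which are invariant themselves (`exists_eventually_tiles`), and removing one
point makes a stabilizer trivial (`exists_leftFree_erase`). If `P` is such a partition of `F`, and
`F₀` is invariant relative to the pieces but small relative to `F`, then each piece lies in nearly
`|F₀|` of the translates `F₀ g`, so `φ F` and `|F₀|⁻¹ ∑ g ∈ F, φ (F₀ g)` are both close to the sum
of `φ` over `P`. By equivariance the second one is the additive map generated by `φ F₀ / |F₀|`
(`exists_eventually_norm_sub_average_le`).

*Riesz-almost additivity.* Solidity of the semi-norm turns an error `ξ` into the invariant error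
`sup_g ‖ξ (g • F)‖`, and for bounded functions an error `b` into the constant function `b • 1`. In
`L¹[0,1]` the densities of `F ↦ bump |F|` tend to zero in norm but together dominate `1 / x`, while
Riesz-almost additivity along partitions into points would give them an integrable upper bound.
-/

/-! ### Counting in translates of finite sets -/

namespace SetMap

universe u v

section Counting

/-- The one-point set `{x}`, as an element of `FinSets α`. -/
def single {α : Type u} (x : α) : FinSets α := ⟨{x}, Finset.singleton_nonempty x⟩


open Classical

variable {G : Type u} [Group G]

theorem mem_gact {g x : G} {F : FinSets G} : x ∈ (gact g F).1 ↔ x * g ∈ F.1 := by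
  simp only [gact, Finset.mem_map_equiv]
  simp

theorem coe_gact (g : G) (F : FinSets G) : (gact g F).1 = MulOpposite.op g⁻¹ • F.1 := by
  ext x
  rw [mem_gact, MulOpposite.op_inv, Finset.mem_inv_smul_finset_iff, op_smul_eq_mul]

theorem card_gact (g : G) (F : FinSets G) : (gact g F).1.card = F.1.card :=
  Finset.card_map _

theorem gact_mul (g h : G) (F : FinSets G) : gact (g * h) F = gact g (gact h F) := by
  ext x
  simp [mem_gact, mul_assoc]

theorem isAlmostInvariant_gact {K : FinSets G} {δ : ℝ} {g : G} {F : FinSets G} :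
    IsAlmostInvariant K δ (gact g F) ↔ IsAlmostInvariant K δ F := by
  unfold IsAlmostInvariant
  rw [card_gact, coe_gact, mul_smul_comm, ← Finset.smul_finset_symmDiff, Finset.card_smul_finset]

theorem card_pos {α : Type u} (F : FinSets α) : (0 : ℝ) < F.1.card := by
  exact_mod_cast F.2.card_pos

theorem gact_single_one (x : G) : gact x⁻¹ (single (1 : G)) = single x := by
  ext y
  simp only [mem_gact]
  simp [single, mul_inv_eq_one]

theorem card_sdiff_smul (k : G) (F : Finset G) : (F \ (k • F)).card = ((k • F) \ F).card :=
  Finset.card_sdiff_comm (Finset.card_smul_finset k F).symm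

/-- The part of `F` missed by `K * F` is no larger than the part of `K * F` outside `F`. -/
theorem card_sdiff_mul_le {K K' : Finset G} (hK : K.Nonempty) (h : K ⊆ K') (F : Finset G) :
    (F \ (K * F)).card ≤ ((K' * F) \ F).card := by
  obtain ⟨k, hk⟩ := hK
  calc (F \ (K * F)).card ≤ (F \ (k • F)).card :=
        Finset.card_le_card (Finset.sdiff_subset_sdiff subset_rfl
          (Finset.smul_finset_subset_mul hk))
    _ = ((k • F) \ F).card := card_sdiff_smul k F
    _ ≤ _ := Finset.card_le_card (Finset.sdiff_subset_sdiff
          (Finset.smul_finset_subset_mul (h hk)) subset_rfl)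

theorem card_symmDiff_eq {α : Type u} (A B : Finset α) :
    (A ∆ B).card = (A \ B).card + (B \ A).card :=
  Finset.card_union_of_disjoint disjoint_sdiff_sdiff

theorem card_mul_symmDiff_le {K K' : Finset G} (hK : K.Nonempty) (h : K ⊆ K') (F : Finset G) :
    ((K * F) ∆ F).card ≤ 2 * ((K' * F) \ F).card := by
  have h1 := card_sdiff_mul_le hK h F
  have h2 : ((K * F) \ F).card ≤ ((K' * F) \ F).card := Finset.card_le_card
    (Finset.sdiff_subset_sdiff (Finset.mul_subset_mul_right h) subset_rfl)
  rw [card_symmDiff_eq]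
  omega

theorem IsAlmostInvariant.card_mul_sdiff_le {K F : FinSets G} {δ : ℝ}
    (h : IsAlmostInvariant K δ F) : (((K.1 * F.1) \ F.1).card : ℝ) ≤ δ * F.1.card := by
  refine le_trans ?_ h
  rw [card_symmDiff_eq]
  push_cast
  linarith [Nat.cast_nonneg (α := ℝ) (F.1 \ (K.1 * F.1)).card]

theorem IsAlmostInvariant.mono {K K' F : FinSets G} {δ δ' : ℝ} (hK : K.1 ⊆ K'.1)
    (hδ : 2 * δ' ≤ δ) (h : IsAlmostInvariant K' δ' F) : IsAlmostInvariant K δ F := by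
  have h1 := h.card_mul_sdiff_le
  have h2 : (((K.1 * F.1) ∆ F.1).card : ℝ) ≤ 2 * ((K'.1 * F.1) \ F.1).card := by
    exact_mod_cast card_mul_symmDiff_le K.2 hK F.1
  unfold IsAlmostInvariant
  nlinarith [card_pos F]

/-! ### The filter of increasingly invariant sets -/

variable (G) in
/-- The filter on `FinSets G` whose members contain all `(K, δ)`-invariant sets for some
`(K, δ)`; a property holds along it iff it holds for all sufficiently invariant sets. -/
def invFilter : Filter (FinSets G) where
  sets := {S | ∃ (K : FinSets G) (δ : ℝ), 0 < δ ∧ ∀ F, IsAlmostInvariant K δ F → F ∈ S}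
  univ_sets := ⟨single 1, 1, one_pos, fun _ _ => trivial⟩
  sets_of_superset := by
    rintro S T ⟨K, δ, hδ, h⟩ hST
    exact ⟨K, δ, hδ, fun F hF => hST (h F hF)⟩
  inter_sets := by
    rintro S T ⟨K, δ, hδ, h⟩ ⟨K', δ', hδ', h'⟩
    refine ⟨⟨K.1 ∪ K'.1, K.2.mono Finset.subset_union_left⟩, min δ δ' / 2,
      half_pos (lt_min hδ hδ'), fun F hF => ⟨h F ?_, h' F ?_⟩⟩
    · exact hF.mono Finset.subset_union_left (by linarith [min_le_left δ δ'])
    · exact hF.mono Finset.subset_union_right (by linarith [min_le_right δ δ'])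

open Filter

theorem eventually_invFilter {p : FinSets G → Prop} :
    (∀ᶠ F in invFilter G, p F) ↔
      ∃ (K : FinSets G) (δ : ℝ), 0 < δ ∧ ∀ F, IsAlmostInvariant K δ F → p F := Iff.rfl

theorem IsAmenable.neBot (hG : IsAmenable G) : (invFilter G).NeBot := by
  refine ⟨fun h => ?_⟩
  have h0 : ∀ᶠ _ in invFilter G, False := by rw [h]; exact eventually_bot
  obtain ⟨K, δ, hδ, h⟩ := eventually_invFilter.1 h0
  obtain ⟨F, hF⟩ := hG K δ hδ
  exact h F hF

theorem eventually_card_mul_sdiff_le (K : Finset G) {δ : ℝ} (hδ : 0 < δ) :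
    ∀ᶠ F in invFilter G, (((K * F.1) \ F.1).card : ℝ) ≤ δ * F.1.card := by
  refine eventually_invFilter.2 ⟨⟨insert 1 K, Finset.insert_nonempty _ _⟩, δ, hδ,
    fun F hF => le_trans ?_ hF.card_mul_sdiff_le⟩
  exact_mod_cast Finset.card_le_card (Finset.sdiff_subset_sdiff
    (Finset.mul_subset_mul_right (Finset.subset_insert 1 K)) subset_rfl)

theorem card_le_of_card_mul_sdiff_le {K F : Finset G} {δ : ℝ}
    (h : (((K * F) \ F).card : ℝ) ≤ δ * F.card) : ((K * F).card : ℝ) ≤ (1 + δ) * F.card := by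
  have : ((K * F).card : ℝ) ≤ ((K * F) \ F).card + F.card := by
    exact_mod_cast Finset.card_le_card_sdiff_add_card
  linarith

theorem eventually_card_mul_le (K : Finset G) {δ : ℝ} (hδ : 0 < δ) :
    ∀ᶠ F in invFilter G, ((K * F.1).card : ℝ) ≤ (1 + δ) * F.1.card :=
  (eventually_card_mul_sdiff_le K hδ).mono fun _ h => card_le_of_card_mul_sdiff_le h

theorem eventually_le_card [Infinite G] (c : ℝ) : ∀ᶠ F in invFilter G, c ≤ (F.1.card : ℝ) := by
  obtain ⟨K, hK⟩ := Infinite.exists_subset_card_eq G ⌈2 * c⌉₊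
  refine (eventually_card_mul_le K one_pos).mono fun F hF => ?_
  have h1 : (K.card : ℝ) ≤ (K * F.1).card := by
    exact_mod_cast Finset.card_le_card_mul_right F.2
  have h2 : 2 * c ≤ K.card := by rw [hK]; exact Nat.le_ceil _
  linarith

end Counting

/-! ### Monotone invariant partitions from pieces with trivial stabilizer -/

section Monotone

open Classical

variable {G : Type u} [Group G]

/-- The left stabilizer of `E` in `G` is trivial. -/
def LeftFree (E : Finset G) : Prop := ∀ k : G, k • E = E → k = 1

theorem leftFree_singleton (x : G) : LeftFree ({x} : Finset G) := by
  intro k hk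
  simpa using hk

/-- A finite set with nontrivial stabilizer acquires a trivial one when a suitable point is
removed. Otherwise every `x ∈ Q` has some `k x ≠ 1` stabilizing `Q \ {x}`; for a fixed `q ∈ Q` the
points `q` and `k x * q`, `x ≠ q`, then exhaust `Q` and leave no room for `h * q`, where `h ≠ 1`
stabilizes `Q`. -/
theorem exists_leftFree_erase {Q : Finset G} (hQ : Q.Nonempty) (h : ¬ LeftFree Q) :
    ∃ x ∈ Q, LeftFree (Q.erase x) ∧ (Q.erase x).Nonempty := by
  obtain ⟨q, hq⟩ := hQ
  simp only [LeftFree, not_forall] at h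
  obtain ⟨h, hhQ, hh⟩ := h
  have hmul : ∀ y ∈ Q, h * y ∈ Q := fun y hy => by
    rw [← hhQ]; exact Finset.smul_mem_smul_finset hy
  have hne : ∀ x ∈ Q, (Q.erase x).Nonempty := fun x hx =>
    ⟨h * x, Finset.mem_erase.2 ⟨fun e => hh (by simpa using e), hmul x hx⟩⟩
  by_contra! hcon
  have hk : ∀ x, ∃ k : G, x ∈ Q → k ≠ 1 ∧ k • Q.erase x = Q.erase x := by
    intro x
    by_cases hx : x ∈ Q
    · have : ¬ LeftFree (Q.erase x) := fun hf => (hne x hx).ne_empty (hcon x hx hf)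
      simp only [LeftFree, not_forall] at this
      obtain ⟨k, hk, hk1⟩ := this
      exact ⟨k, fun _ => ⟨hk1, hk⟩⟩
    · exact ⟨1, fun h => absurd h hx⟩
  choose k hk using hk
  have hmem : ∀ x ∈ Q, ∀ y ∈ Q, y ≠ x → k x * y ∈ Q := by
    intro x hx y hy hyx
    have : k x • y ∈ k x • Q.erase x :=
      Finset.smul_mem_smul_finset (Finset.mem_erase.2 ⟨hyx, hy⟩)
    rw [(hk x hx).2] at this
    exact Finset.mem_of_mem_erase this
  have hnot : ∀ x ∈ Q, k x * x ∉ Q := by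
    intro x hx hxQ
    have h1 : k x • x ∈ k x • Q.erase x := by
      rw [(hk x hx).2]
      exact Finset.mem_erase.2 ⟨fun e => (hk x hx).1 (by simpa using e), hxQ⟩
    rw [Finset.smul_mem_smul_finset_iff] at h1
    exact Finset.notMem_erase x Q h1
  let f : G → G := fun x => if x = q then q else k x * q
  have hf : Set.MapsTo f Q Q := by
    intro x hx
    by_cases hxq : x = q
    · simpa [f, hxq] using hq
    · simpa [f, hxq] using hmem x hx q hq (Ne.symm hxq)
  have hinj : Set.InjOn f Q := by
    intro x hx y hy hxy
    by_cases hxq : x = q <;> by_cases hyq : y = q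
    · rw [hxq, hyq]
    · exact absurd (by simpa [f, hxq, hyq] using hxy) (hk y hy).1
    · exact absurd (by simpa [f, hxq, hyq] using hxy) (hk x hx).1
    · have e : k x = k y := by simpa [f, hxq, hyq] using hxy
      by_contra hne'
      exact hnot x hx (by rw [e]; exact hmem y hy x hx hne')
  obtain ⟨x, hx, hxe⟩ := Finset.surjOn_of_injOn_of_card_le f hf hinj le_rfl (hmul q hq)
  by_cases hxq : x = q
  · exact hh (by simpa [f, hxq] using hxe.symm)
  · have e : k x = h := by simpa [f, hxq] using hxe
    exact hnot x hx (by rw [e]; exact hmul x hx)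

/-- In a finite set `C` each of whose points `z` has another point of `C` in `z • D`, a maximal
family of points with disjoint translates of `D * E` bounds `|C * E|` from below and
`|C * F|` from above. -/
theorem exists_packing {C D E F : Finset G} {s : ℕ} (hE : LeftFree E) (hEne : E.Nonempty)
    (h1 : 1 ∈ D) (hD : ∀ a ∈ E, ∀ b ∈ E, a * b⁻¹ ∈ D) (hDinv : ∀ d ∈ D, d⁻¹ ∈ D)
    (hF : (D * D * D * F).card ≤ F.card + s)
    (hC : ∀ z ∈ C, ∃ k ∈ C, k ≠ z ∧ z⁻¹ * k ∈ D) :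
    ∃ n : ℕ, (C.Nonempty → 1 ≤ n) ∧ n * (E.card + 1) ≤ (C * E).card ∧
      (C * F).card ≤ n * (F.card + s) := by
  let good : Finset G → Prop := fun Z =>
    ∀ z ∈ Z, ∀ z' ∈ Z, z ≠ z' → Disjoint (z • (D * E)) (z' • (D * E))
  obtain ⟨Z, hZ, hmax⟩ := Finset.exists_max_image (C.powerset.filter good) Finset.card
    ⟨∅, by simp [good]⟩
  rw [Finset.mem_filter, Finset.mem_powerset] at hZ
  obtain ⟨hZC, hZg⟩ := hZ
  have hcover : C ⊆ Z * (D * D * D) := by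
    intro k hk
    have key : ∃ z ∈ Z, ¬ Disjoint (k • (D * E)) (z • (D * E)) := by
      by_cases hkZ : k ∈ Z
      · refine ⟨k, hkZ, ?_⟩
        rw [disjoint_self, Finset.bot_eq_empty, ← Finset.not_nonempty_iff_eq_empty, not_not]
        exact (Finset.Nonempty.mul ⟨1, h1⟩ hEne).smul_finset
      · by_contra! hdis
        have hmem : insert k Z ∈ C.powerset.filter good := by
          rw [Finset.mem_filter, Finset.mem_powerset]
          refine ⟨Finset.insert_subset hk hZC, ?_⟩
          intro z hz z' hz' hne
          rw [Finset.mem_insert] at hz hz'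
          rcases hz with rfl | hz <;> rcases hz' with rfl | hz'
          · exact absurd rfl hne
          · exact hdis z' hz'
          · exact (hdis z hz).symm
          · exact hZg z hz z' hz' hne
        have := hmax _ hmem
        rw [Finset.card_insert_of_notMem hkZ] at this
        omega
    obtain ⟨z, hz, hnd⟩ := key
    rw [Finset.not_disjoint_iff] at hnd
    obtain ⟨y, hy, hy'⟩ := hnd
    obtain ⟨_, hu, rfl⟩ := Finset.mem_smul_finset.1 hy
    obtain ⟨d, hd, e, he, rfl⟩ := Finset.mem_mul.1 hu
    obtain ⟨_, hu', heq⟩ := Finset.mem_smul_finset.1 hy'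
    obtain ⟨d', hd', e', he', rfl⟩ := Finset.mem_mul.1 hu'
    have : k = z * (d' * (e' * e⁻¹) * d⁻¹) := by
      simp only [smul_eq_mul] at heq
      have h2 : k = (k * (d * e)) * e⁻¹ * d⁻¹ := by group
      rw [h2, ← heq]
      group
    rw [this]
    exact Finset.mul_mem_mul hz (Finset.mul_mem_mul
      (Finset.mul_mem_mul hd' (hD e' he' e he)) (hDinv d hd))
  refine ⟨Z.card, ?_, ?_, ?_⟩
  · rintro ⟨c, hc⟩
    obtain ⟨z, hz, -⟩ := Finset.mem_mul.1 (hcover hc)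
    exact Finset.card_pos.2 ⟨z, hz⟩
  · have hsub : Z.biUnion (fun z => (C.filter fun c => z⁻¹ * c ∈ D) * E) ⊆ C * E := by
      refine Finset.biUnion_subset.2 fun z _ => Finset.mul_subset_mul_right ?_
      exact Finset.filter_subset _ _
    refine le_trans ?_ (Finset.card_le_card hsub)
    rw [Finset.card_biUnion]
    · rw [← smul_eq_mul]
      refine Finset.card_nsmul_le_sum _ _ _ fun z hz => ?_
      obtain ⟨k, hk, hkz, hkD⟩ := hC z (hZC hz)
      have hlt : z • E ⊂ z • E ∪ k • E := by
        refine Finset.ssubset_iff_subset_ne.2 ⟨Finset.subset_union_left, fun heq => ?_⟩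
        have hsub : k • E ⊆ z • E := by rw [heq]; exact Finset.subset_union_right
        have heq' : k • E = z • E := Finset.eq_of_subset_of_card_le hsub (by simp)
        have : (z⁻¹ * k) • E = E := by rw [mul_smul, heq', inv_smul_smul]
        exact hkz (inv_mul_eq_one.1 (hE _ this)).symm
      have hlt' := Finset.card_lt_card hlt
      rw [Finset.card_smul_finset] at hlt'
      refine le_trans hlt' (Finset.card_le_card (Finset.union_subset ?_ ?_))
      · exact Finset.smul_finset_subset_mul (Finset.mem_filter.2 ⟨hZC hz, by simpa using h1⟩)
      · exact Finset.smul_finset_subset_mul (Finset.mem_filter.2 ⟨hk, hkD⟩)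
    · intro z hz z' hz' hne
      have hsub : ∀ w : G, (C.filter fun c => w⁻¹ * c ∈ D) * E ⊆ w • (D * E) := by
        intro w x hx
        obtain ⟨c, hc, e, he, rfl⟩ := Finset.mem_mul.1 hx
        refine Finset.mem_smul_finset.2 ⟨w⁻¹ * c * e,
          Finset.mul_mem_mul (Finset.mem_filter.1 hc).2 he, ?_⟩
        simp [mul_assoc]
      exact (hZg z hz z' hz' hne).mono (hsub z) (hsub z')
  · calc (C * F).card ≤ (Z * (D * D * D) * F).card :=
          Finset.card_le_card (Finset.mul_subset_mul_right hcover)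
      _ = (Z * (D * D * D * F)).card := by rw [mul_assoc]
      _ ≤ Z.card * (D * D * D * F).card := Finset.card_mul_le
      _ ≤ _ := Nat.mul_le_mul_left _ hF

theorem card_insert_one_mul (K F : Finset G) :
    (insert 1 K * F).card = ((K * F) \ F).card + F.card := by
  rw [Finset.insert_eq, Finset.union_mul, Finset.singleton_mul, Finset.card_sdiff_add_card]
  simp [Finset.union_comm]

/-- A finite set `E` with trivial left stabilizer is at most as invariant, with respect to every
finite `K`, as any sufficiently invariant set `F`. A point `z` of `K ∪ {1}` whose translate `z • E`
is disjoint from all others contributes at least as much to `|K * E| / |E|` as to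
`|K * F| / |F|`. The other points fall into clusters on which `|K * E|` is at least `|E| + 1` and
`|K * F|` is at most `|F|` plus a small error. -/
theorem card_mul_card_symmDiff_le {D E F K : Finset G} {M : ℕ} (hE : LeftFree E)
    (hEne : E.Nonempty) (h1 : 1 ∈ D) (hD : ∀ a ∈ E, ∀ b ∈ E, a * b⁻¹ ∈ D)
    (hDinv : ∀ d ∈ D, d⁻¹ ∈ D) (hM : E.card ≤ M)
    (hF : 2 * M * ((D * D * D * F) \ F).card ≤ F.card) :
    E.card * ((K * F) ∆ F).card ≤ F.card * ((K * E) ∆ E).card := by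
  set s := ((D * D * D * F) \ F).card with hs
  have hms : 2 * (E.card * s) ≤ F.card := by
    have := Nat.mul_le_mul_right s hM
    linarith
  set L := insert 1 K with hL
  set I := L.filter fun z => ∀ k ∈ L, z⁻¹ * k ∈ D → k = z with hI
  set C := L.filter fun z => ¬ ∀ k ∈ L, z⁻¹ * k ∈ D → k = z with hCdef
  have hLIC : L = I ∪ C := (Finset.filter_union_filter_not_eq _ _).symm
  have hsep : ∀ z ∈ I, ∀ k ∈ L, ∀ a ∈ E, ∀ b ∈ E, z * a = k * b → k = z := by
    intro z hz k hk a ha b hb hab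
    refine (Finset.mem_filter.1 hz).2 k hk ?_
    have : z⁻¹ * k = a * b⁻¹ := by
      rw [eq_mul_inv_iff_mul_eq, mul_assoc, ← hab, inv_mul_cancel_left]
    rw [this]
    exact hD a ha b hb
  have hIL : I ⊆ L := Finset.filter_subset _ _
  have hCL : C ⊆ L := Finset.filter_subset _ _
  have hC : ∀ z ∈ C, ∃ k ∈ C, k ≠ z ∧ z⁻¹ * k ∈ D := by
    intro z hz
    obtain ⟨hzL, hz'⟩ := Finset.mem_filter.1 hz
    push Not at hz'
    obtain ⟨k, hk, hkD, hkz⟩ := hz'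
    refine ⟨k, Finset.mem_filter.2 ⟨hk, fun h => hkz (h z hzL ?_).symm⟩, hkz, hkD⟩
    simpa using hDinv _ hkD
  have hIE : (I * E).card = I.card * E.card := by
    rw [Finset.card_mul_iff]
    rintro ⟨z, a⟩ ⟨hz, ha⟩ ⟨k, b⟩ ⟨hk, hb⟩ hab
    have hab' : z * a = k * b := hab
    obtain rfl : k = z := hsep z hz k (hIL hk) a ha b hb hab'
    simpa using hab'
  have hLE : I.card * E.card + (C * E).card ≤ (L * E).card := by
    rw [hLIC, Finset.union_mul, Finset.card_union_of_disjoint, hIE]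
    rw [Finset.disjoint_left]
    intro x hx hx'
    obtain ⟨z, hz, a, ha, rfl⟩ := Finset.mem_mul.1 hx
    obtain ⟨k, hk, b, hb, hab⟩ := Finset.mem_mul.1 hx'
    obtain rfl := hsep z hz k (hCL hk) a ha b hb hab.symm
    exact (Finset.mem_filter.1 hk).2 (Finset.mem_filter.1 hz).2
  have hLF : (L * F).card ≤ I.card * F.card + (C * F).card := by
    rw [hLIC, Finset.union_mul]
    exact (Finset.card_union_le _ _).trans (Nat.add_le_add_right Finset.card_mul_le _)
  have hDF : (D * D * D * F).card ≤ F.card + s := by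
    rw [hs, add_comm]
    exact Finset.card_le_card_sdiff_add_card
  obtain ⟨n, hn, hnE, hnF⟩ := exists_packing hE hEne h1 hD hDinv hDF hC
  rw [hL, card_insert_one_mul] at hLE hLF
  rw [card_symmDiff_eq, card_symmDiff_eq]
  have hupper : E.card * (((K * F) \ F).card + F.card) + n * (E.card * s) ≤
      F.card * (((K * E) \ E).card + E.card) := by
    have e1 := Nat.mul_le_mul_left E.card (hLF.trans (Nat.add_le_add_left hnF _))
    have e2 := Nat.mul_le_mul_left F.card ((Nat.add_le_add_left hnE _).trans hLE)
    have e3 := Nat.mul_le_mul_left n hms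
    nlinarith
  have h1L : (1 : G) ∈ L := Finset.mem_insert_self _ _
  have hcase : E.card * (F \ (K * F)).card ≤
      F.card * (E \ (K * E)).card + n * (E.card * s) := by
    by_cases h1C : (1 : G) ∈ C
    · obtain ⟨k, hkC, hk1, hkD⟩ := hC 1 h1C
      have hkK : k ∈ K := (Finset.mem_insert.1 (hCL hkC)).resolve_left hk1
      have hsub : ({k} : Finset G) ⊆ D * D * D := by
        rw [Finset.singleton_subset_iff]
        have := Finset.mul_mem_mul (Finset.mul_mem_mul h1 h1) hkD
        simpa using this
      have h2 : (F \ (K * F)).card ≤ s :=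
        (Finset.card_le_card (Finset.sdiff_subset_sdiff subset_rfl
          (Finset.mul_subset_mul_right (Finset.singleton_subset_iff.2 hkK)))).trans
          (card_sdiff_mul_le (Finset.singleton_nonempty k) hsub F)
      have h3 := Nat.mul_le_mul_left E.card h2
      have h4 := Nat.mul_le_mul_right (E.card * s) (hn ⟨1, h1C⟩)
      nlinarith
    · have h1I : (1 : G) ∈ I := by
        rw [hLIC] at h1L
        exact (Finset.mem_union.1 h1L).resolve_right h1C
      by_cases h1K : (1 : G) ∈ K
      · have : F \ (K * F) = ∅ := Finset.sdiff_eq_empty_iff_subset.2 fun x hx => by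
          simpa using Finset.mul_mem_mul h1K hx
        simp [this]
      · have : E \ (K * E) = E := by
          refine Finset.sdiff_eq_self_of_disjoint (Finset.disjoint_left.2 fun x hx hx' => ?_)
          obtain ⟨k, hk, b, hb, hab⟩ := Finset.mem_mul.1 hx'
          obtain rfl := hsep 1 h1I k (Finset.mem_insert_of_mem hk) x hx b hb (by rw [hab, one_mul])
          exact h1K hk
        rw [this, mul_comm]
        have h2 : (F \ (K * F)).card ≤ F.card := Finset.card_le_card Finset.sdiff_subset
        exact (Nat.mul_le_mul_right E.card h2).trans (Nat.le_add_right _ _)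
  nlinarith

theorem IsPartition.isMonotonePartition {D : Finset G} {F : FinSets G} {P : Finset (FinSets G)}
    {M : ℕ} (hP : IsPartition P F) (hfree : ∀ E ∈ P, LeftFree E.1) (h1 : 1 ∈ D)
    (hDinv : ∀ d ∈ D, d⁻¹ ∈ D) (hD : ∀ E ∈ P, ∀ a ∈ E.1, ∀ b ∈ E.1, a * b⁻¹ ∈ D)
    (hM : ∀ E ∈ P, E.1.card ≤ M) (hF : 2 * M * ((D * D * D * F.1) \ F.1).card ≤ F.1.card) :
    IsMonotonePartition P F := by
  refine ⟨hP, fun K δ hδ E hE hinv => ?_⟩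
  have h : (E.1.card : ℝ) * ((K.1 * F.1) ∆ F.1).card ≤ F.1.card * ((K.1 * E.1) ∆ E.1).card := by
    exact_mod_cast card_mul_card_symmDiff_le (hfree E hE) E.2 h1 (hD E hE) hDinv (hM E hE) hF
  unfold IsAlmostInvariant at hinv ⊢
  have hpos := card_pos E
  have := mul_le_mul_of_nonneg_left hinv (card_pos F).le
  refine le_of_mul_le_mul_left ?_ hpos
  linarith

end Monotone

/-! ### Partitions of invariant sets into pieces of bounded size -/

section Tiles

open Classical

variable {α : Type u}

/-- `P` is a partition of the possibly empty finite set `A` into nonempty finite sets. -/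
structure Tiles (P : Finset (FinSets α)) (A : Finset α) : Prop where
  disjoint : ∀ E ∈ P, ∀ E' ∈ P, E ≠ E' → Disjoint E.1 E'.1
  cover : ∀ x : α, x ∈ A ↔ ∃ E ∈ P, x ∈ E.1

theorem Tiles.isPartition {P : Finset (FinSets α)} {F : FinSets α} (h : Tiles P F.1) :
    IsPartition P F := ⟨h.disjoint, h.cover⟩

theorem IsPartition.tiles {P : Finset (FinSets α)} {F : FinSets α} (h : IsPartition P F) :
    Tiles P F.1 := ⟨h.disjoint, h.cover⟩

theorem Tiles.subset {P : Finset (FinSets α)} {A : Finset α} (h : Tiles P A) {E : FinSets α}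
    (hE : E ∈ P) : E.1 ⊆ A := fun _ hx => (h.cover _).2 ⟨E, hE, hx⟩

theorem Tiles.sum_card {P : Finset (FinSets α)} {A : Finset α} (h : Tiles P A) :
    ∑ E ∈ P, E.1.card = A.card := by
  have : A = P.biUnion fun E => E.1 := by
    ext x
    simp only [h.cover x, Finset.mem_biUnion]
  rw [this, Finset.card_biUnion h.disjoint]

theorem tiles_self (E : FinSets α) : Tiles {E} E.1 := by
  refine ⟨fun A hA B hB hne => ?_, fun x => by simp⟩
  rw [Finset.mem_singleton] at hA hB
  exact absurd (hA.trans hB.symm) hne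

theorem Tiles.union {P Q : Finset (FinSets α)} {A B : Finset α} (hP : Tiles P A)
    (hQ : Tiles Q B) (h : Disjoint A B) : Tiles (P ∪ Q) (A ∪ B) := by
  refine ⟨fun E hE E' hE' hne => ?_, fun x => ?_⟩
  · rcases Finset.mem_union.1 hE with hE | hE <;> rcases Finset.mem_union.1 hE' with hE' | hE'
    · exact hP.disjoint E hE E' hE' hne
    · exact h.mono (hP.subset hE) (hQ.subset hE')
    · exact (h.mono (hP.subset hE') (hQ.subset hE)).symm
    · exact hQ.disjoint E hE E' hE' hne
  · simp only [Finset.mem_union, hP.cover, hQ.cover, or_and_right, exists_or]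

theorem Tiles.disjoint_of_disjoint {P Q : Finset (FinSets α)} {A B : Finset α} (hP : Tiles P A)
    (hQ : Tiles Q B) (h : Disjoint A B) : Disjoint P Q := by
  refine Finset.disjoint_left.2 fun E hE hE' => ?_
  obtain ⟨x, hx⟩ := E.2
  exact Finset.disjoint_left.1 h (hP.subset hE hx) (hQ.subset hE' hx)

/-- The partition of a finite set into its points. -/
noncomputable def singles (A : Finset α) : Finset (FinSets α) := A.image single

theorem tiles_singles (A : Finset α) : Tiles (singles A) A := by
  refine ⟨fun E hE E' hE' hne => ?_, fun x => ?_⟩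
  · obtain ⟨x, -, rfl⟩ := Finset.mem_image.1 hE
    obtain ⟨y, -, rfl⟩ := Finset.mem_image.1 hE'
    exact Finset.disjoint_singleton.2 fun h => hne (by rw [h])
  · simp [singles, single]

theorem sum_singles {M : Type v} [AddCommMonoid M] (A : Finset α) (f : FinSets α → M) :
    ∑ E ∈ singles A, f E = ∑ x ∈ A, f (single x) := by
  refine Finset.sum_image fun x _ y _ h => ?_
  simpa [single] using congrArg Subtype.val h

theorem mem_singles {A : Finset α} {E : FinSets α} (hE : E ∈ singles A) :
    ∃ x ∈ A, E = single x := by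
  obtain ⟨x, hx, rfl⟩ := Finset.mem_image.1 hE
  exact ⟨x, hx, rfl⟩

end Tiles

section Greedy

open Classical Filter

variable {G : Type u} [Group G]

/-- A nonnegative set function `β` that is negligible on invariant sets has a small sum over a
partition of `E` into pieces with trivial stabilizer, up to an error that is proportional to the
boundary of `E`. Sets with a large boundary are cut into points; from the others at most one point
is removed. -/
theorem exists_tiles_leftFree [Infinite G] {β : FinSets G → ℝ} {B : ℝ} (hB : 0 ≤ B)
    (hβB : ∀ F, β F ≤ B * F.1.card)
    (hβ : ∀ ε : ℝ, 0 < ε → ∀ᶠ F in invFilter G, β F ≤ ε * F.1.card) {ε : ℝ} (hε : 0 < ε) :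
    ∃ (K : Finset G) (c : ℝ), (∀ k ∈ K, k⁻¹ ∈ K) ∧ 0 ≤ c ∧ ∀ E : FinSets G,
      ∃ R : Finset (FinSets G), Tiles R E.1 ∧ (∀ E' ∈ R, LeftFree E'.1) ∧
        ∑ E' ∈ R, β E' ≤ ε * E.1.card + c * ((K * E.1) \ E.1).card := by
  obtain ⟨K₁, δ, hδ, hK₁⟩ := eventually_invFilter.1 (hβ (ε / 2) (half_pos hε))
  set m : ℝ := max (8 / δ) (2 * B / ε) with hm
  obtain ⟨K₂, hK₂⟩ := Infinite.exists_subset_card_eq G ⌈2 * m⌉₊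
  set δ' : ℝ := min (δ / 8) 1 with hδ'def
  have hδ' : 0 < δ' := lt_min (by positivity) one_pos
  set S : Finset G := K₁.1 ∪ K₂
  refine ⟨S ∪ S⁻¹, B / δ', ?_, by positivity, fun E => ?_⟩
  · intro k hk
    simpa [or_comm] using hk
  set K := S ∪ S⁻¹
  have hE0 := card_pos E
  have hKK₁ : K₁.1 ⊆ K := Finset.subset_union_left.trans Finset.subset_union_left
  have hKK₂ : K₂ ⊆ K := Finset.subset_union_right.trans Finset.subset_union_left
  by_cases hbad : δ' * E.1.card < ((K * E.1) \ E.1).card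
  · refine ⟨singles E.1, tiles_singles _, ?_, ?_⟩
    · intro E' hE'
      obtain ⟨x, -, rfl⟩ := mem_singles hE'
      exact leftFree_singleton x
    · rw [sum_singles]
      have h1 : ∑ x ∈ E.1, β (single x) ≤ E.1.card * B := by
        rw [← nsmul_eq_mul]
        refine Finset.sum_le_card_nsmul _ _ _ fun x _ => ?_
        simpa [single] using hβB (single x)
      have h2 : E.1.card * B ≤ B / δ' * ((K * E.1) \ E.1).card := by
        have := mul_le_mul_of_nonneg_left hbad.le (div_nonneg hB hδ'.le)
        calc E.1.card * B = B / δ' * (δ' * E.1.card) := by field_simp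
          _ ≤ _ := this
      have : 0 ≤ ε * E.1.card := by positivity
      linarith
  · rw [not_lt] at hbad
    have hcard : m ≤ E.1.card := by
      have h1 : (K₂.card : ℝ) ≤ (K * E.1).card := by
        exact_mod_cast (Finset.card_le_card_mul_right E.2).trans
          (Finset.card_le_card (Finset.mul_subset_mul_right hKK₂))
      have h2 : 2 * m ≤ K₂.card := by rw [hK₂]; exact Nat.le_ceil _
      have h3 := card_le_of_card_mul_sdiff_le hbad
      have h4 : (1 + δ') * E.1.card ≤ 2 * E.1.card :=
        mul_le_mul_of_nonneg_right (by linarith [min_le_right (δ / 8) 1]) hE0.le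
      linarith
    have h8 : 8 ≤ δ * E.1.card := by
      have := (le_max_left _ _).trans hcard
      rwa [div_le_iff₀ hδ, mul_comm] at this
    have hBE : B ≤ ε / 2 * E.1.card := by
      have := (le_max_right _ _).trans hcard
      rw [div_le_iff₀ hε] at this
      linarith
    have hδE : δ' * E.1.card ≤ δ / 8 * E.1.card :=
      mul_le_mul_of_nonneg_right (min_le_left _ _) hE0.le
    have hc : 0 ≤ B / δ' * ((K * E.1) \ E.1).card := by positivity
    by_cases hfree : LeftFree E.1
    · refine ⟨{E}, tiles_self E, by simpa using hfree, ?_⟩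
      have hinv : IsAlmostInvariant K₁ δ E := by
        have : (((K₁.1 * E.1) ∆ E.1).card : ℝ) ≤ 2 * ((K * E.1) \ E.1).card := by
          exact_mod_cast card_mul_symmDiff_le K₁.2 hKK₁ E.1
        unfold IsAlmostInvariant
        nlinarith
      rw [Finset.sum_singleton]
      have := hK₁ E hinv
      nlinarith
    · obtain ⟨x, hx, hxfree, hxne⟩ := exists_leftFree_erase E.2 hfree
      have hdis : Disjoint (E.1.erase x) {x} := by simp
      have hE' := (tiles_self ⟨E.1.erase x, hxne⟩).union (tiles_self (single x)) hdis
      have hdis' : ⟨E.1.erase x, hxne⟩ ∉ ({single x} : Finset (FinSets G)) := by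
        intro h
        rw [Finset.mem_singleton] at h
        have := congrArg Subtype.val h
        simp only [single] at this
        rw [this] at hdis
        simp at hdis
      refine ⟨{⟨E.1.erase x, hxne⟩} ∪ {single x}, ?_, ?_, ?_⟩
      · convert hE' using 1
        ext y
        by_cases hyx : y = x <;> simp [single, hyx, hx]
      · intro E' hE'
        rcases Finset.mem_union.1 hE' with h | h
        · rw [Finset.mem_singleton.1 h]; exact hxfree
        · rw [Finset.mem_singleton.1 h]; exact leftFree_singleton x
      · rw [Finset.sum_union (Finset.disjoint_singleton_left.2 hdis'), Finset.sum_singleton,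
          Finset.sum_singleton]
        have hcard' : ((E.1.erase x).card : ℝ) = E.1.card - 1 := by
          rw [Finset.card_erase_of_mem hx, Nat.cast_sub E.2.card_pos, Nat.cast_one]
        have hinv : IsAlmostInvariant K₁ δ ⟨E.1.erase x, hxne⟩ := by
          have h1 : (((K₁.1 * E.1.erase x) ∆ E.1.erase x).card : ℝ) ≤
              2 * ((K * E.1.erase x) \ E.1.erase x).card := by
            exact_mod_cast card_mul_symmDiff_le K₁.2 hKK₁ (E.1.erase x)
          have h2 : (((K * E.1.erase x) \ E.1.erase x).card : ℝ) ≤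
              ((K * E.1) \ E.1).card + 1 := by
            have hsub : (K * E.1.erase x) \ E.1.erase x ⊆ insert x ((K * E.1) \ E.1) := by
              intro y hy
              rw [Finset.mem_sdiff, Finset.mem_erase, not_and_or, not_not] at hy
              rw [Finset.mem_insert, Finset.mem_sdiff]
              refine hy.2.imp_right fun h => ⟨?_, h⟩
              exact Finset.mul_subset_mul_left (Finset.erase_subset _ _) hy.1
            exact_mod_cast (Finset.card_le_card hsub).trans (Finset.card_insert_le _ _)
          have h2E : (2 : ℝ) ≤ E.1.card := by
            have := Finset.card_pos.2 hxne
            rw [Finset.card_erase_of_mem hx] at this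
            exact_mod_cast (by omega : 2 ≤ E.1.card)
          unfold IsAlmostInvariant
          rw [hcard']
          nlinarith
        have h1 := hK₁ _ hinv
        rw [hcard'] at h1
        have h2 : β (single x) ≤ B := by simpa [single] using hβB (single x)
        nlinarith

/-- The number of pairs `(k, a)` in `K × A` with `k * a ∈ B`. -/
noncomputable def cross (K A B : Finset G) : ℕ := ((K ×ˢ A).filter fun p => p.1 * p.2 ∈ B).card

/-- The number of pairs `(k, a)` in `K × A` with `k * a ∉ A`. -/
noncomputable def out (K A : Finset G) : ℕ := ((K ×ˢ A).filter fun p => p.1 * p.2 ∉ A).card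

theorem cross_add_out (K A : Finset G) : cross K A A + out K A = K.card * A.card := by
  rw [cross, out, Finset.card_filter_add_card_filter_not, Finset.card_product]

theorem cross_union_left (K : Finset G) {A A' : Finset G} (B : Finset G) (h : Disjoint A A') :
    cross K (A ∪ A') B = cross K A B + cross K A' B := by
  rw [cross, Finset.product_union, Finset.filter_union, Finset.card_union_of_disjoint]
  · rfl
  · exact Finset.disjoint_filter_filter (Finset.disjoint_product.2 (Or.inr h))

theorem cross_union_right (K A : Finset G) {B B' : Finset G} (h : Disjoint B B') :
    cross K A (B ∪ B') = cross K A B + cross K A B' := by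
  unfold cross
  simp only [Finset.mem_union]
  rw [Finset.filter_or, Finset.card_union_of_disjoint]
  exact Finset.disjoint_filter.2 fun p _ hp hp' => Finset.disjoint_left.1 h hp hp'

theorem cross_comm {K : Finset G} (hK : ∀ k ∈ K, k⁻¹ ∈ K) (A B : Finset G) :
    cross K A B = cross K B A := by
  refine Finset.card_nbij' (fun p => (p.1⁻¹, p.1 * p.2)) (fun p => (p.1⁻¹, p.1 * p.2)) ?_ ?_ ?_ ?_
  · rintro ⟨k, a⟩ h
    simp only [Finset.coe_filter, Finset.mem_product, Set.mem_ofPred_eq] at h ⊢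
    exact ⟨⟨hK k h.1.1, h.2⟩, by simpa using h.1.2⟩
  · rintro ⟨k, a⟩ h
    simp only [Finset.coe_filter, Finset.mem_product, Set.mem_ofPred_eq] at h ⊢
    exact ⟨⟨hK k h.1.1, h.2⟩, by simpa using h.1.2⟩
  · rintro ⟨k, a⟩ -
    simp
  · rintro ⟨k, a⟩ -
    simp

theorem out_add_out {K : Finset G} (hK : ∀ k ∈ K, k⁻¹ ∈ K) {A A' : Finset G}
    (h : Disjoint A A') : out K A + out K A' = out K (A ∪ A') + 2 * cross K A A' := by
  have h1 := cross_add_out K A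
  have h2 := cross_add_out K A'
  have h3 := cross_add_out K (A ∪ A')
  rw [cross_union_left K _ h, cross_union_right K A h, cross_union_right K A' h,
    cross_comm hK A' A, Finset.card_union_of_disjoint h, mul_add] at h3
  omega

theorem card_mul_sdiff_le_out (K A : Finset G) : ((K * A) \ A).card ≤ out K A := by
  refine (Finset.card_le_card ?_).trans
    (Finset.card_image_le (f := fun p : G × G => p.1 * p.2))
  intro x hx
  obtain ⟨hx, hxA⟩ := Finset.mem_sdiff.1 hx
  obtain ⟨k, hk, a, ha, rfl⟩ := Finset.mem_mul.1 hx
  exact Finset.mem_image.2 ⟨(k, a), by simp [hk, ha, hxA], rfl⟩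

theorem out_le (K A : Finset G) : out K A ≤ K.card * ((K * A) \ A).card := by
  rw [← Finset.card_product]
  refine Finset.card_le_card_of_injOn (fun p => (p.1, p.1 * p.2)) ?_ ?_
  · rintro ⟨k, a⟩ h
    simp only [Finset.coe_filter, Finset.mem_product, Set.mem_ofPred_eq] at h
    simp only [Finset.coe_product, Set.mem_prod, Finset.mem_coe, Finset.mem_sdiff]
    exact ⟨h.1.1, Finset.mul_mem_mul h.1.1 h.1.2, h.2⟩
  · rintro ⟨k, a⟩ - ⟨k', a'⟩ - h
    simp only [Prod.mk.injEq] at h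
    obtain ⟨rfl, h⟩ := h
    simpa using h

/-- If `T` is sufficiently invariant, then some right translate of `T` meets `A` in a set with few
edges to the rest of `A`. This holds on average over the translates of `T` that meet `A`. -/
theorem exists_translate_cross_le {K T A : Finset G} {η : ℝ}
    (hT : (((K * T) \ T).card : ℝ) ≤ η * T.card) (hTne : T.Nonempty) (hA : A.Nonempty) :
    ∃ g : G, (A.filter fun a => a * g⁻¹ ∈ T).Nonempty ∧
      (cross K (A.filter fun a => a * g⁻¹ ∈ T) (A \ A.filter fun a => a * g⁻¹ ∈ T) : ℝ) ≤
        K.card * η * (A.filter fun a => a * g⁻¹ ∈ T).card := by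
  set W : G → Finset G := fun g => A.filter fun a => a * g⁻¹ ∈ T with hW
  set Γ : Finset G := T⁻¹ * A
  have h1 : A.card * T.card ≤ ∑ g ∈ Γ, (W g).card := by
    rw [← Finset.card_product, ← Finset.card_sigma]
    refine Finset.card_le_card_of_injOn (fun p => ⟨p.2⁻¹ * p.1, p.1⟩) ?_ ?_
    · rintro ⟨a, t⟩ h
      simp only [Finset.coe_product, Set.mem_prod, Finset.mem_coe] at h
      simp only [Finset.coe_sigma, Set.mem_sigma_iff, Finset.mem_coe, hW, Finset.mem_filter]
      exact ⟨Finset.mul_mem_mul (Finset.inv_mem_inv h.2) h.1, h.1, by simpa using h.2⟩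
    · rintro ⟨a, t⟩ - ⟨a', t'⟩ - h
      simp only [Sigma.mk.injEq, heq_eq_eq] at h
      obtain ⟨h, rfl⟩ := h
      simpa using h
  have h2 : ∑ g ∈ Γ, cross K (W g) (A \ W g) ≤ A.card * out K T := by
    unfold cross out
    rw [← Finset.card_product, ← Finset.card_sigma]
    refine Finset.card_le_card_of_injOn (fun q => (q.2.2, (q.2.1, q.2.2 * q.1⁻¹))) ?_ ?_
    · rintro ⟨g, k, a⟩ h
      simp only [Finset.coe_sigma, Set.mem_sigma_iff, Finset.mem_coe, hW, Finset.mem_filter,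
        Finset.mem_product, Finset.mem_sdiff, not_and] at h
      obtain ⟨-, ⟨hk, ha, hat⟩, hka, hkat⟩ := h
      simp only [Finset.coe_product, Set.mem_prod, Finset.mem_coe, Finset.mem_filter,
        Finset.mem_product]
      exact ⟨ha, ⟨hk, hat⟩, by rw [← mul_assoc]; exact hkat hka⟩
    · rintro ⟨g, k, a⟩ - ⟨g', k', a'⟩ - h
      simp only [Prod.mk.injEq] at h
      obtain ⟨rfl, rfl, h⟩ := h
      obtain rfl : g = g' := by simpa using h
      rfl
  have h3 : (out K T : ℝ) ≤ K.card * (η * T.card) :=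
    le_trans (by exact_mod_cast out_le K T) (mul_le_mul_of_nonneg_left hT (Nat.cast_nonneg _))
  have h0 : 0 ≤ η := by
    have : (0 : ℝ) < T.card := by exact_mod_cast hTne.card_pos
    by_contra! hneg
    have h4 : (0 : ℝ) ≤ ((K * T) \ T).card := Nat.cast_nonneg _
    nlinarith
  have hsum : ∑ g ∈ Γ, (cross K (W g) (A \ W g) : ℝ) ≤
      ∑ g ∈ Γ, K.card * η * ((W g).card : ℝ) := by
    have h1' : (A.card : ℝ) * T.card ≤ ∑ g ∈ Γ, ((W g).card : ℝ) := by exact_mod_cast h1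
    have h2' : ∑ g ∈ Γ, (cross K (W g) (A \ W g) : ℝ) ≤ A.card * out K T := by exact_mod_cast h2
    rw [← Finset.mul_sum]
    calc _ ≤ (A.card : ℝ) * out K T := h2'
      _ ≤ A.card * (K.card * (η * T.card)) := mul_le_mul_of_nonneg_left h3 (Nat.cast_nonneg _)
      _ = K.card * η * (A.card * T.card) := by ring
      _ ≤ _ := mul_le_mul_of_nonneg_left h1' (by positivity)
  obtain ⟨g, hg, hle⟩ := Finset.exists_le_of_sum_le (hTne.inv.mul hA) hsum
  refine ⟨g, ?_, hle⟩
  obtain ⟨t, ht, a, ha, rfl⟩ := Finset.mem_mul.1 hg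
  exact ⟨a, Finset.mem_filter.2 ⟨ha, by simpa using ht⟩⟩

/-- Repeatedly removing from `A` its intersection with a translate of `T` that has few edges to
the remaining set, and refining the pieces, gives a partition of `A` with small total error. -/
theorem exists_tiles_le {β : FinSets G → ℝ} {K T : Finset G} {ε c η : ℝ}
    (hK : ∀ k ∈ K, k⁻¹ ∈ K) (hc : 0 ≤ c)
    (hR : ∀ E : FinSets G, ∃ R : Finset (FinSets G), Tiles R E.1 ∧ (∀ E' ∈ R, LeftFree E'.1) ∧
        ∑ E' ∈ R, β E' ≤ ε * E.1.card + c * ((K * E.1) \ E.1).card)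
    (hT : (((K * T) \ T).card : ℝ) ≤ η * T.card) (hTne : T.Nonempty) (A : Finset G) :
    ∃ P : Finset (FinSets G), Tiles P A ∧
      (∀ E ∈ P, LeftFree E.1 ∧ ∃ g : G, ∀ a ∈ E.1, a * g⁻¹ ∈ T) ∧
      ∑ E ∈ P, β E ≤ (ε + 2 * c * (K.card * η)) * A.card + c * out K A := by
  induction A using Finset.strongInduction with
  | H A ih =>
    rcases A.eq_empty_or_nonempty with rfl | hA
    · exact ⟨∅, ⟨by simp, by simp⟩, by simp, by simp [out]⟩
    obtain ⟨g, hne, hle⟩ := exists_translate_cross_le hT hTne hA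
    set E := A.filter fun a => a * g⁻¹ ∈ T with hE
    have hEA : E ⊆ A := Finset.filter_subset _ _
    obtain ⟨P, hP, hPT, hPβ⟩ := ih (A \ E) (Finset.sdiff_ssubset hEA hne)
    obtain ⟨R, hRE, hRfree, hRβ⟩ := hR ⟨E, hne⟩
    have hdis : Disjoint E (A \ E) := Finset.disjoint_sdiff
    have hun : E ∪ (A \ E) = A := Finset.union_sdiff_of_subset hEA
    have hRP := hRE.union hP hdis
    simp only [hun] at hRP
    refine ⟨R ∪ P, hRP, ?_, ?_⟩
    · intro E' hE'
      rcases Finset.mem_union.1 hE' with h | h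
      · exact ⟨hRfree E' h, g, fun a ha => (Finset.mem_filter.1 (hRE.subset h ha)).2⟩
      · exact hPT E' h
    · rw [Finset.sum_union (hRE.disjoint_of_disjoint hP hdis)]
      have h1 : (out K E : ℝ) + out K (A \ E) = out K A + 2 * cross K E (A \ E) := by
        have := out_add_out hK hdis
        rw [hun] at this
        exact_mod_cast this
      have h2 : (E.card : ℝ) + (A \ E).card = A.card := by
        have := Finset.card_union_of_disjoint hdis
        rw [hun] at this
        exact_mod_cast this.symm
      have h3 : (((K * E) \ E).card : ℝ) ≤ out K E := by exact_mod_cast card_mul_sdiff_le_out K E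
      have h4 := mul_le_mul_of_nonneg_left h3 hc
      have h5 := mul_le_mul_of_nonneg_left hle hc
      have h6 := congrArg (fun t => c * t) h1
      rw [← h2]
      simp only at hRβ h6
      linarith

/-- A nonnegative set function that is negligible on invariant sets has a small sum over suitable
partitions of invariant sets into pieces with trivial stabilizer and of bounded size: the pieces
lie in right translates of a finite set `T`, which does not depend on the partitioned set. -/
theorem exists_eventually_tiles [Infinite G] (hG : IsAmenable G) {β : FinSets G → ℝ} {B : ℝ}
    (hB : 0 ≤ B) (hβB : ∀ F, β F ≤ B * F.1.card)
    (hβ : ∀ ε : ℝ, 0 < ε → ∀ᶠ F in invFilter G, β F ≤ ε * F.1.card) {ε : ℝ} (hε : 0 < ε) :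
    ∃ T : Finset G, T.Nonempty ∧ ∀ᶠ F in invFilter G, ∃ P : Finset (FinSets G), Tiles P F.1 ∧
      (∀ E ∈ P, LeftFree E.1 ∧ ∃ g : G, ∀ a ∈ E.1, a * g⁻¹ ∈ T) ∧
      ∑ E ∈ P, β E ≤ ε * F.1.card := by
  obtain ⟨K, c, hK, hc, hR⟩ := exists_tiles_leftFree hB hβB hβ (ε := ε / 3) (by positivity)
  have := hG.neBot
  set η : ℝ := ε / (6 * (c + 1) * (K.card + 1)) with hη
  have hη0 : 0 < η := by positivity
  have hηε : (c + 1) * (K.card + 1) * η = ε / 6 := by rw [hη]; field_simp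
  have hcK : c * (K.card * η) ≤ ε / 6 := by
    rw [← hηε]
    nlinarith [mul_nonneg hc hη0.le, mul_nonneg (Nat.cast_nonneg (α := ℝ) K.card) hη0.le]
  obtain ⟨T, hT⟩ := (eventually_card_mul_sdiff_le K hη0).exists
  refine ⟨T.1, T.2, (eventually_card_mul_sdiff_le K hη0).mono fun F hF => ?_⟩
  obtain ⟨P, hP, hPT, hPβ⟩ := exists_tiles_le hK hc hR hT T.2 F.1
  refine ⟨P, hP, hPT, hPβ.trans ?_⟩
  have h1 : (out K F.1 : ℝ) ≤ K.card * (η * F.1.card) :=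
    le_trans (by exact_mod_cast out_le K F.1) (mul_le_mul_of_nonneg_left hF (Nat.cast_nonneg _))
  have h2 := mul_le_mul_of_nonneg_left h1 hc
  have h3 := mul_le_mul_of_nonneg_right hcK (card_pos F).le
  nlinarith

end Greedy

/-! ### Averaging over translates of a window -/

section Window

open Classical Filter

variable {G : Type u} [Group G] {V : Type v} [SeminormedAddCommGroup V]

theorem norm_sum_sub_sum_le {α : Type u} {f : α → V} {C : ℝ} (hf : ∀ x, ‖f x‖ ≤ C)
    (s t : Finset α) : ‖∑ x ∈ s, f x - ∑ x ∈ t, f x‖ ≤ (s ∆ t).card * C := by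
  rw [← Finset.sum_sdiff_sub_sum_sdiff, card_symmDiff_eq, Nat.cast_add, add_mul]
  refine (norm_sub_le _ _).trans (add_le_add ?_ ?_) <;>
  · rw [← nsmul_eq_mul]
    exact norm_sum_le_of_le _ (fun x _ => hf x) |>.trans_eq (by simp)

/-- The pieces of a partition that lie inside `W` give, together with the remaining points of `W`,
a monotone invariant partition of `W`. -/
theorem norm_sub_sum_filter_le {φ : FinSets G → V} {b : FinSets G → ℝ} {B : ℝ}
    (hφ : ∀ F, ‖φ F‖ ≤ B * F.1.card) (hb : ∀ F, |b F| ≤ B * F.1.card)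
    (hφb : ∀ (F : FinSets G) (P : Finset (FinSets G)), IsMonotonePartition P F →
      ‖φ F - ∑ E ∈ P, φ E‖ ≤ ∑ E ∈ P, b E)
    {T A : Finset G} (hT : T.Nonempty) {P : Finset (FinSets G)} (hP : Tiles P A)
    (hPT : ∀ E ∈ P, LeftFree E.1 ∧ ∃ g : G, ∀ a ∈ E.1, a * g⁻¹ ∈ T) {W : FinSets G}
    (hW : 2 * T.card * (((T * T⁻¹) * (T * T⁻¹) * (T * T⁻¹) * W.1) \ W.1).card ≤ W.1.card) :
    ‖φ W - ∑ E ∈ P.filter (fun E => E.1 ⊆ W.1), φ E‖ ≤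
      ∑ E ∈ P.filter (fun E => E.1 ⊆ W.1), |b E| +
        2 * B * (W.1.card - ∑ E ∈ P.filter (fun E => E.1 ⊆ W.1), (E.1.card : ℝ)) := by
  set Q := P.filter (fun E => E.1 ⊆ W.1) with hQ
  set U := Q.biUnion fun E => E.1 with hU
  have hQU : Tiles Q U :=
    ⟨fun E hE E' hE' => hP.disjoint E (Finset.mem_filter.1 hE).1 E' (Finset.mem_filter.1 hE').1,
      fun x => by simp only [hU, Finset.mem_biUnion]⟩
  have hUW : U ⊆ W.1 := Finset.biUnion_subset.2 fun E hE => (Finset.mem_filter.1 hE).2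
  have hdis : Disjoint U (W.1 \ U) := Finset.disjoint_sdiff
  have htiles := hQU.union (tiles_singles (W.1 \ U)) hdis
  rw [Finset.union_sdiff_of_subset hUW] at htiles
  have h1 : (1 : G) ∈ T * T⁻¹ := by
    obtain ⟨t, ht⟩ := hT
    simpa using Finset.mul_mem_mul ht (Finset.inv_mem_inv ht)
  have hinv : ∀ d ∈ T * T⁻¹, d⁻¹ ∈ T * T⁻¹ := by
    intro d hd
    obtain ⟨s, hs, t, ht, rfl⟩ := Finset.mem_mul.1 hd
    rw [mul_inv_rev]
    exact Finset.mul_mem_mul (by simpa using ht) (Finset.inv_mem_inv hs)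
  have hmono : IsMonotonePartition (Q ∪ singles (W.1 \ U)) W := by
    refine htiles.isPartition.isMonotonePartition (D := T * T⁻¹) (M := T.card) ?_ h1 hinv ?_ ?_ hW
    · intro E hE
      rcases Finset.mem_union.1 hE with h | h
      · exact (hPT E (Finset.mem_filter.1 h).1).1
      · obtain ⟨x, -, rfl⟩ := mem_singles h
        exact leftFree_singleton x
    · intro E hE x hx y hy
      rcases Finset.mem_union.1 hE with h | h
      · obtain ⟨g, hg⟩ := (hPT E (Finset.mem_filter.1 h).1).2
        have : x * y⁻¹ = (x * g⁻¹) * (y * g⁻¹)⁻¹ := by group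
        rw [this]
        exact Finset.mul_mem_mul (hg x hx) (Finset.inv_mem_inv (hg y hy))
      · obtain ⟨z, -, rfl⟩ := mem_singles h
        simp only [single, Finset.mem_singleton] at hx hy
        rw [hx, hy, mul_inv_cancel]
        exact h1
    · intro E hE
      rcases Finset.mem_union.1 hE with h | h
      · obtain ⟨g, hg⟩ := (hPT E (Finset.mem_filter.1 h).1).2
        exact Finset.card_le_card_of_injOn (fun a => a * g⁻¹) hg fun x _ y _ hxy => by
          simpa using hxy
      · obtain ⟨z, -, rfl⟩ := mem_singles h
        exact hT.card_pos
  have key := hφb W _ hmono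
  have hd := hQU.disjoint_of_disjoint (tiles_singles (W.1 \ U)) hdis
  rw [Finset.sum_union hd, Finset.sum_union hd, sum_singles, sum_singles] at key
  have hcard : ((W.1 \ U).card : ℝ) = W.1.card - ∑ E ∈ Q, (E.1.card : ℝ) := by
    rw [Finset.card_sdiff_of_subset hUW, Nat.cast_sub (Finset.card_le_card hUW), ← hQU.sum_card]
    push_cast
    rfl
  rw [← hcard]
  have h2 : ‖∑ x ∈ W.1 \ U, φ (single x)‖ ≤ (W.1 \ U).card * B := by
    rw [← nsmul_eq_mul, ← Finset.sum_const]
    exact norm_sum_le_of_le _ fun x _ => by simpa [single] using hφ (single x)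
  have h3 : ∑ x ∈ W.1 \ U, b (single x) ≤ (W.1 \ U).card * B := by
    rw [← nsmul_eq_mul, ← Finset.sum_const]
    exact Finset.sum_le_sum fun x _ => (le_abs_self _).trans (by simpa [single] using hb (single x))
  have h4 : ∑ E ∈ Q, b E ≤ ∑ E ∈ Q, |b E| := Finset.sum_le_sum fun E _ => le_abs_self _
  have h5 : φ W - ∑ E ∈ Q, φ E = (φ W - (∑ E ∈ Q, φ E + ∑ x ∈ W.1 \ U, φ (single x))) +
      ∑ x ∈ W.1 \ U, φ (single x) := by abel
  rw [h5]
  refine (norm_add_le _ _).trans ?_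
  linarith

theorem sum_sum_filter_eq {α : Type u} {M : Type v} [AddCommMonoid M] (Γ : Finset α)
    (P : Finset (FinSets α)) (W : α → FinSets α) (f : FinSets α → M) :
    ∑ g ∈ Γ, ∑ E ∈ P.filter (fun E => E.1 ⊆ (W g).1), f E =
      ∑ E ∈ P, (Γ.filter fun g => E.1 ⊆ (W g).1).card • f E := by
  simp only [Finset.sum_filter]
  rw [Finset.sum_comm]
  refine Finset.sum_congr rfl fun E _ => ?_
  rw [← Finset.sum_filter, Finset.sum_const]

theorem mem_translate {g x : G} {F : FinSets G} : x ∈ (gact g⁻¹ F).1 ↔ x * g⁻¹ ∈ F.1 :=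
  mem_gact

theorem card_filter_translate_le (E F₀ : FinSets G) (Γ : Finset G) :
    (Γ.filter fun g => E.1 ⊆ (gact g⁻¹ F₀).1).card ≤ F₀.1.card := by
  obtain ⟨e, he⟩ := E.2
  refine Finset.card_le_card_of_injOn (fun g => e * g⁻¹) (fun g hg => ?_) fun g _ g' _ h => ?_
  · exact mem_translate.1 ((Finset.mem_filter.1 hg).2 he)
  · simpa using h

theorem le_card_filter_translate {E F₀ : FinSets G} {F D : Finset G} (hEF : E.1 ⊆ F)
    (hD : ∀ a ∈ E.1, ∀ b ∈ E.1, a * b⁻¹ ∈ D) :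
    F₀.1.card ≤ ((F₀.1⁻¹ * F).filter fun g => E.1 ⊆ (gact g⁻¹ F₀).1).card + out D F₀.1 := by
  obtain ⟨e, he⟩ := E.2
  set Y := F₀.1.filter fun y => ∀ d ∈ D, d * y ∈ F₀.1 with hY
  have h1 : Y.card ≤ ((F₀.1⁻¹ * F).filter fun g => E.1 ⊆ (gact g⁻¹ F₀).1).card := by
    refine Finset.card_le_card_of_injOn (fun y => y⁻¹ * e) (fun y hy => ?_) fun y _ y' _ h => ?_
    · obtain ⟨hy0, hy⟩ := Finset.mem_filter.1 hy
      refine Finset.mem_coe.2 (Finset.mem_filter.2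
        ⟨Finset.mul_mem_mul (Finset.inv_mem_inv hy0) (hEF he), fun a ha => mem_translate.2 ?_⟩)
      have : a * (y⁻¹ * e)⁻¹ = a * e⁻¹ * y := by group
      rw [this]
      exact hy _ (hD a ha e he)
    · simpa using h
  have h2 : (F₀.1 \ Y).card ≤ out D F₀.1 := by
    refine (Finset.card_le_card ?_).trans (Finset.card_image_le (f := Prod.snd))
    intro y hy
    simp only [hY, Finset.mem_sdiff, Finset.mem_filter, not_and, not_forall] at hy
    obtain ⟨d, hd, hdy⟩ := hy.2 hy.1
    exact Finset.mem_image.2 ⟨(d, y), by simp [hd, hy.1, hdy], rfl⟩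
  have hYF : Y ⊆ F₀.1 := Finset.filter_subset _ _
  have h3 := Finset.card_sdiff_add_card_eq_card hYF
  omega

variable [NormedSpace ℝ V]

/-- Comparison of `|F₀| • φ F` with the sum of `φ` over the translates `F₀ * g`, `g ∈ F`, where `F₀`
is invariant relative to the pieces of a partition `P` of `F`, and `F` is invariant relative to
`F₀`. Both are close to `|F₀|` times the sum of `φ` over `P`, because each piece lies in nearly
`|F₀|` of the translates. -/
theorem norm_card_smul_sub_sum_le {φ : FinSets G → V} {b : FinSets G → ℝ} {B : ℝ} (hB : 0 ≤ B)
    (hφ : ∀ F, ‖φ F‖ ≤ B * F.1.card) (hb : ∀ F, |b F| ≤ B * F.1.card)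
    (hφb : ∀ (F : FinSets G) (P : Finset (FinSets G)), IsMonotonePartition P F →
      ‖φ F - ∑ E ∈ P, φ E‖ ≤ ∑ E ∈ P, b E)
    {T : Finset G} (hT : T.Nonempty) {F F₀ : FinSets G} {P : Finset (FinSets G)}
    (hP : Tiles P F.1) (hPT : ∀ E ∈ P, LeftFree E.1 ∧ ∃ g : G, ∀ a ∈ E.1, a * g⁻¹ ∈ T) {ε : ℝ}
    (hPb : ∑ E ∈ P, |b E| ≤ ε * F.1.card)
    (hF : 2 * T.card * (((T * T⁻¹) * (T * T⁻¹) * (T * T⁻¹) * F.1) \ F.1).card ≤ F.1.card)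
    (hF₀ : 2 * T.card * (((T * T⁻¹) * (T * T⁻¹) * (T * T⁻¹) * F₀.1) \ F₀.1).card ≤ F₀.1.card)
    (hout : (out (T * T⁻¹) F₀.1 : ℝ) ≤ ε * F₀.1.card)
    (hΓ : ((F₀.1⁻¹ * F.1).card : ℝ) ≤ (1 + ε) * F.1.card)
    (hΓF : (((F₀.1⁻¹ * F.1) ∆ F.1).card : ℝ) ≤ ε * F.1.card) :
    ‖(F₀.1.card : ℝ) • φ F - ∑ g ∈ F.1, φ (gact g⁻¹ F₀)‖ ≤
      ε * (2 + 6 * B) * F₀.1.card * F.1.card := by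
  set Γ := F₀.1⁻¹ * F.1
  set W : G → FinSets G := fun g => gact g⁻¹ F₀ with hWdef
  set N : FinSets G → ℕ := fun E => (Γ.filter fun g => E.1 ⊆ (W g).1).card with hN
  set n : ℝ := (F₀.1.card : ℝ) with hn
  have hn0 : 0 < n := card_pos F₀
  have hWcard : ∀ g, (W g).1.card = F₀.1.card := fun g => card_gact _ _
  have hNle : ∀ E, (N E : ℝ) ≤ n := fun E =>
    Nat.cast_le.2 (card_filter_translate_le E F₀ Γ)
  have hNge : ∀ E ∈ P, n - N E ≤ ε * n := by
    intro E hE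
    have : F₀.1.card ≤ N E + out (T * T⁻¹) F₀.1 := by
      refine le_card_filter_translate (hP.subset hE) fun x hx y hy => ?_
      obtain ⟨g, hg⟩ := (hPT E hE).2
      have : x * y⁻¹ = (x * g⁻¹) * (y * g⁻¹)⁻¹ := by group
      rw [this]
      exact Finset.mul_mem_mul (hg x hx) (Finset.inv_mem_inv (hg y hy))
    have : n ≤ (N E + out (T * T⁻¹) F₀.1 : ℕ) := Nat.cast_le.2 this
    rw [Nat.cast_add] at this
    linarith
  have hPcard : ∑ E ∈ P, (E.1.card : ℝ) = F.1.card := by exact_mod_cast hP.sum_card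
  have hWinv : ∀ g, 2 * T.card *
      (((T * T⁻¹) * (T * T⁻¹) * (T * T⁻¹) * (W g).1) \ (W g).1).card ≤ (W g).1.card := by
    intro g
    rw [hWcard, hWdef]
    simp only [coe_gact]
    rwa [mul_smul_comm, ← Finset.smul_finset_sdiff, Finset.card_smul_finset]
  -- the translates `W g` and the pieces inside them
  have a1 : ‖∑ g ∈ Γ, φ (W g) - ∑ E ∈ P, (N E : ℝ) • φ E‖ ≤
      n * (ε * F.1.card) + 2 * B * (2 * ε * n * F.1.card) := by
    have e1 : ∑ E ∈ P, (N E : ℝ) • φ E =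
        ∑ g ∈ Γ, ∑ E ∈ P.filter (fun E => E.1 ⊆ (W g).1), φ E := by
      rw [sum_sum_filter_eq]
      exact Finset.sum_congr rfl fun E _ => by rw [Nat.cast_smul_eq_nsmul]
    have e2 : ∑ g ∈ Γ, ∑ E ∈ P.filter (fun E => E.1 ⊆ (W g).1), |b E| ≤ n * (ε * F.1.card) := by
      rw [sum_sum_filter_eq]
      refine le_trans ?_ (mul_le_mul_of_nonneg_left hPb hn0.le)
      rw [Finset.mul_sum]
      refine Finset.sum_le_sum fun E _ => ?_
      rw [nsmul_eq_mul]
      exact mul_le_mul_of_nonneg_right (hNle E) (abs_nonneg _)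
    have e3 : (1 - ε) * n * F.1.card ≤
        ∑ g ∈ Γ, ∑ E ∈ P.filter (fun E => E.1 ⊆ (W g).1), (E.1.card : ℝ) := by
      rw [sum_sum_filter_eq, ← hPcard, Finset.mul_sum]
      refine Finset.sum_le_sum fun E hE => ?_
      rw [nsmul_eq_mul]
      exact mul_le_mul_of_nonneg_right (by linarith [hNge E hE]) (Nat.cast_nonneg _)
    rw [e1, ← Finset.sum_sub_distrib]
    refine (norm_sum_le_of_le _ fun g _ =>
      norm_sub_sum_filter_le hφ hb hφb hT hP hPT (hWinv g)).trans ?_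
    rw [Finset.sum_add_distrib, ← Finset.mul_sum, Finset.sum_sub_distrib]
    simp only [hWcard, Finset.sum_const, nsmul_eq_mul]
    refine add_le_add e2 (mul_le_mul_of_nonneg_left ?_ (by positivity))
    have := mul_le_mul_of_nonneg_right hΓ hn0.le
    linarith
  -- each piece lies in nearly `n` of the translates
  have a2 : ‖∑ E ∈ P, (N E : ℝ) • φ E - n • ∑ E ∈ P, φ E‖ ≤ ε * n * B * F.1.card := by
    rw [Finset.smul_sum, ← Finset.sum_sub_distrib, ← hPcard, Finset.mul_sum]
    refine norm_sum_le_of_le _ fun E hE => ?_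
    rw [← sub_smul, norm_smul, Real.norm_eq_abs, abs_sub_comm,
      abs_of_nonneg (sub_nonneg.2 (hNle E)), mul_assoc]
    exact mul_le_mul (hNge E hE) (hφ E) (norm_nonneg _)
      ((sub_nonneg.2 (hNle E)).trans (hNge E hE))
  have a3 : ‖n • ∑ E ∈ P, φ E - n • φ F‖ ≤ n * (ε * F.1.card) := by
    rw [← smul_sub, norm_smul, Real.norm_of_nonneg hn0.le, norm_sub_rev]
    refine mul_le_mul_of_nonneg_left ?_ hn0.le
    have h := norm_sub_sum_filter_le hφ hb hφb hT hP hPT hF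
    rw [Finset.filter_true_of_mem fun E hE => hP.subset hE, hPcard, sub_self, mul_zero,
      add_zero] at h
    exact h.trans hPb
  have a4 : ‖∑ g ∈ Γ, φ (W g) - ∑ g ∈ F.1, φ (W g)‖ ≤ ε * F.1.card * (B * n) := by
    refine (norm_sum_sub_sum_le (fun g => (hφ (W g)).trans_eq ?_) Γ F.1).trans
      (mul_le_mul_of_nonneg_right hΓF (by positivity))
    rw [hWcard]
  have e : n • φ F - ∑ g ∈ F.1, φ (W g) =
      (∑ g ∈ Γ, φ (W g) - ∑ g ∈ F.1, φ (W g)) -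
        ((∑ g ∈ Γ, φ (W g) - ∑ E ∈ P, (N E : ℝ) • φ E) +
        (∑ E ∈ P, (N E : ℝ) • φ E - n • ∑ E ∈ P, φ E) +
        (n • ∑ E ∈ P, φ E - n • φ F)) := by abel
  rw [e]
  refine (norm_sub_le _ _).trans ?_
  have h1 := norm_add₃_le (a := ∑ g ∈ Γ, φ (W g) - ∑ E ∈ P, (N E : ℝ) • φ E)
    (b := ∑ E ∈ P, (N E : ℝ) • φ E - n • ∑ E ∈ P, φ E) (c := n • ∑ E ∈ P, φ E - n • φ F)
  linarith

/-- On sufficiently invariant sets, an almost additive map is close to the additive map generated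
by `φ F₀ / |F₀|`, for a fixed invariant set `F₀`. -/
theorem exists_eventually_norm_sub_average_le [Infinite G] (hG : IsAmenable G)
    {φ : FinSets G → V} {b : FinSets G → ℝ} {B : ℝ} (hB : 0 ≤ B)
    (hφ : ∀ F, ‖φ F‖ ≤ B * F.1.card) (hb : ∀ F, |b F| ≤ B * F.1.card)
    (hb0 : ∀ ε : ℝ, 0 < ε → ∀ᶠ F in invFilter G, |b F| ≤ ε * F.1.card)
    (hφb : ∀ (F : FinSets G) (P : Finset (FinSets G)), IsMonotonePartition P F →
      ‖φ F - ∑ E ∈ P, φ E‖ ≤ ∑ E ∈ P, b E) {ε : ℝ} (hε : 0 < ε) :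
    ∃ F₀ : FinSets G, ∀ᶠ F in invFilter G,
      ‖φ F - ∑ g ∈ F.1, (F₀.1.card : ℝ)⁻¹ • φ (gact g⁻¹ F₀)‖ ≤ ε * F.1.card := by
  set ε' := ε / (2 + 6 * B) with hε'def
  have hε' : 0 < ε' := by positivity
  obtain ⟨T, hT, hTev⟩ := exists_eventually_tiles hG hB hb hb0 hε'
  have := hG.neBot
  have hTc : (0 : ℝ) < T.card := by exact_mod_cast hT.card_pos
  have hinv : ∀ᶠ F in invFilter G, 2 * T.card *
      (((T * T⁻¹) * (T * T⁻¹) * (T * T⁻¹) * F.1) \ F.1).card ≤ F.1.card := by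
    refine (eventually_card_mul_sdiff_le ((T * T⁻¹) * (T * T⁻¹) * (T * T⁻¹))
      (δ := (2 * (T.card : ℝ))⁻¹) (by positivity)).mono fun F hF => ?_
    rw [inv_mul_eq_div, le_div_iff₀ (by positivity), mul_comm] at hF
    exact_mod_cast hF
  have hout : ∀ᶠ F in invFilter G, (out (T * T⁻¹) F.1 : ℝ) ≤ ε' * F.1.card := by
    have hD : (0 : ℝ) < (T * T⁻¹).card := by exact_mod_cast (hT.mul hT.inv).card_pos
    refine (eventually_card_mul_sdiff_le (T * T⁻¹)
      (δ := ε' / (T * T⁻¹).card) (by positivity)).mono fun F hF => ?_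
    have h1 : (out (T * T⁻¹) F.1 : ℝ) ≤ (T * T⁻¹).card * (((T * T⁻¹) * F.1) \ F.1).card := by
      exact_mod_cast out_le _ _
    refine h1.trans ((mul_le_mul_of_nonneg_left hF hD.le).trans_eq ?_)
    field_simp
  obtain ⟨F₀, hF₀, hF₀out⟩ := (hinv.and hout).exists
  refine ⟨F₀, ?_⟩
  filter_upwards [hTev, hinv, eventually_card_mul_le F₀.1⁻¹ hε',
    eventually_card_mul_sdiff_le F₀.1⁻¹ (half_pos hε')] with F ⟨P, hP, hPT, hPb⟩ hF hΓ hΓF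
  have hΓF' : (((F₀.1⁻¹ * F.1) ∆ F.1).card : ℝ) ≤ ε' * F.1.card := by
    have : (((F₀.1⁻¹ * F.1) ∆ F.1).card : ℝ) ≤ 2 * ((F₀.1⁻¹ * F.1) \ F.1).card := by
      exact_mod_cast card_mul_symmDiff_le F₀.2.inv subset_rfl F.1
    linarith
  have key := norm_card_smul_sub_sum_le hB hφ hb hφb hT hP hPT hPb hF hF₀ hF₀out hΓ hΓF'
  have hn := card_pos F₀
  have e : φ F - ∑ g ∈ F.1, (F₀.1.card : ℝ)⁻¹ • φ (gact g⁻¹ F₀) = (F₀.1.card : ℝ)⁻¹ •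
      ((F₀.1.card : ℝ) • φ F - ∑ g ∈ F.1, φ (gact g⁻¹ F₀)) := by
    rw [smul_sub, inv_smul_smul₀ hn.ne', Finset.smul_sum]
  rw [e, norm_smul, norm_inv, Real.norm_of_nonneg hn.le, inv_mul_le_iff₀ hn]
  refine key.trans_eq ?_
  rw [hε'def]
  field_simp

end Window

/-! ### Semi-norms along the filter of invariant sets -/

section Norms

open Filter

variable {G : Type u} [Group G] {V : Type v} [SeminormedAddCommGroup V] [NormedSpace ℝ V]

theorem normalized_eq {α : Type u} (φ : FinSets α → V) (F : FinSets α) :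
    normalized φ F = ENNReal.ofReal (‖φ F‖ / F.1.card) := by
  rw [normalized, ← ofReal_norm, norm_smul, norm_inv, Real.norm_natCast, inv_mul_eq_div]

theorem normalized_le_ofReal {α : Type u} {φ : FinSets α → V} {F : FinSets α} {r : ℝ}
    (hr : 0 ≤ r) : normalized φ F ≤ ENNReal.ofReal r ↔ ‖φ F‖ ≤ r * F.1.card := by
  rw [normalized_eq, ENNReal.ofReal_le_ofReal_iff hr, div_le_iff₀ (card_pos F)]

theorem asympNorm_le {φ : FinSets G → V} {r : ℝ} (hr : 0 ≤ r)
    (h : ∀ᶠ F in invFilter G, ‖φ F‖ ≤ r * F.1.card) : asympNorm φ ≤ ENNReal.ofReal r := by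
  obtain ⟨K, δ, hδ, h⟩ := eventually_invFilter.1 h
  refine iInf_le_of_le K (iInf_le_of_le δ (iInf_le_of_le hδ ?_))
  exact iSup₂_le fun F hF => (normalized_le_ofReal hr).2 (h F hF)

theorem eventually_le_of_asympNorm_lt {φ : FinSets G → V} {r : ℝ} (hr : 0 ≤ r)
    (h : asympNorm φ < ENNReal.ofReal r) : ∀ᶠ F in invFilter G, ‖φ F‖ ≤ r * F.1.card := by
  simp only [asympNorm, limsupInv, iInf_lt_iff] at h
  obtain ⟨K, δ, hδ, h⟩ := h
  refine eventually_invFilter.2 ⟨K, δ, hδ, fun F hF => (normalized_le_ofReal hr).1 ?_⟩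
  exact (le_iSup₂ (f := fun F (_ : IsAlmostInvariant K δ F) => normalized φ F) F hF).trans h.le

theorem asympNorm_eq_zero_iff {φ : FinSets G → V} :
    asympNorm φ = 0 ↔ ∀ ε : ℝ, 0 < ε → ∀ᶠ F in invFilter G, ‖φ F‖ ≤ ε * F.1.card := by
  refine ⟨fun h ε hε => eventually_le_of_asympNorm_lt hε.le ?_, fun h => ?_⟩
  · rw [h]
    exact ENNReal.ofReal_pos.2 hε
  · refine le_antisymm (ENNReal.le_of_forall_pos_le_add fun ε hε _ => ?_) zero_le
    rw [zero_add, ← ENNReal.ofReal_coe_nnreal]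
    exact asympNorm_le ε.2 (h ε hε)

theorem supNorm_lt_top_iff {α : Type u} {φ : FinSets α → V} :
    supNorm φ < ∞ ↔ ∃ B : ℝ, 0 ≤ B ∧ ∀ F, ‖φ F‖ ≤ B * F.1.card := by
  constructor
  · intro h
    refine ⟨(supNorm φ).toReal, ENNReal.toReal_nonneg, fun F => ?_⟩
    rw [← normalized_le_ofReal ENNReal.toReal_nonneg, ENNReal.ofReal_toReal h.ne]
    exact le_iSup (normalized φ) F
  · rintro ⟨B, hB, h⟩
    exact (iSup_le fun F => (normalized_le_ofReal hB).2 (h F)).trans_lt ENNReal.ofReal_lt_top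

theorem mem_maps_iff {π : G →* (V ≃L[ℝ] V)} {φ : FinSets G → V} :
    φ ∈ maps π ↔ (∃ B : ℝ, 0 ≤ B ∧ ∀ F, ‖φ F‖ ≤ B * F.1.card) ∧ Equivariant π φ :=
  and_congr_left' supNorm_lt_top_iff

theorem mem_asympKernel_iff {π : G →* (V ≃L[ℝ] V)} {φ : FinSets G → V} :
    φ ∈ asympKernel π ↔ φ ∈ maps π ∧
      ∀ ε : ℝ, 0 < ε → ∀ᶠ F in invFilter G, ‖φ F‖ ≤ ε * F.1.card :=
  and_congr_right' asympNorm_eq_zero_iff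

theorem equivariant_one_iff {φ : FinSets G → V} :
    Equivariant (1 : G →* (V ≃L[ℝ] V)) φ ↔ ∀ g F, φ F = φ (gact g F) := Iff.rfl

theorem UniformlyBounded.exists_bound {π : G →* (V ≃L[ℝ] V)} (hπ : UniformlyBounded π) :
    ∃ C : ℝ, 0 ≤ C ∧ ∀ g v, ‖π g v‖ ≤ C * ‖v‖ := by
  obtain ⟨C, hC⟩ := hπ
  exact ⟨C, (norm_nonneg _).trans (hC 1),
    fun g v => ContinuousLinearMap.le_of_opNorm_le (π g : V →L[ℝ] V) (hC g) v⟩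

/-! ### Additive maps -/

/-- The additive set map `F ↦ ∑ g ∈ F, π(g⁻¹) v` with value `v` at `{1}`. -/
noncomputable def addMap (π : G →* (V ≃L[ℝ] V)) (v : V) (F : FinSets G) : V :=
  ∑ g ∈ F.1, π g⁻¹ v

variable {π : G →* (V ≃L[ℝ] V)}

theorem rep_mul_apply (π : G →* (V ≃L[ℝ] V)) (g h : G) (v : V) : π (g * h) v = π g (π h v) := by
  rw [map_mul]
  rfl

theorem addMap_add (v w : V) (F : FinSets G) :
    addMap π (v + w) F = addMap π v F + addMap π w F := by
  simp [addMap, Finset.sum_add_distrib]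

theorem addMap_sub (v w : V) (F : FinSets G) :
    addMap π (v - w) F = addMap π v F - addMap π w F := by
  simp [addMap, Finset.sum_sub_distrib]

theorem addMap_smul (c : ℝ) (v : V) (F : FinSets G) :
    addMap π (c • v) F = c • addMap π v F := by
  simp [addMap, Finset.smul_sum]

theorem norm_addMap_le {C : ℝ} (hC : ∀ g v, ‖π g v‖ ≤ C * ‖v‖) (v : V) (F : FinSets G) :
    ‖addMap π v F‖ ≤ C * ‖v‖ * F.1.card := by
  rw [mul_comm, ← nsmul_eq_mul, ← Finset.sum_const]
  exact norm_sum_le_of_le _ fun g _ => hC _ _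

theorem equivariant_addMap (v : V) : Equivariant π (addMap π v) := by
  intro g F
  simp only [addMap, gact, Finset.sum_map, map_sum]
  refine Finset.sum_congr rfl fun x _ => ?_
  rw [← rep_mul_apply]
  simp

theorem addMap_mem_maps (hπ : UniformlyBounded π) (v : V) : addMap π v ∈ maps π := by
  obtain ⟨C, hC0, hC⟩ := hπ.exists_bound
  exact mem_maps_iff.2 ⟨⟨C * ‖v‖, by positivity, norm_addMap_le hC v⟩, equivariant_addMap v⟩

open Classical in
theorem addMap_eq_sum {F : FinSets G} {P : Finset (FinSets G)} (hP : IsPartition P F) (v : V) :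
    addMap π v F = ∑ E ∈ P, addMap π v E := by
  have : F.1 = P.biUnion fun E => E.1 := by
    ext x
    simp only [hP.cover x, Finset.mem_biUnion]
  rw [addMap, this, Finset.sum_biUnion hP.disjoint]
  rfl

theorem addMap_mem_additiveMaps (hπ : UniformlyBounded π) (v : V) :
    addMap π v ∈ additiveMaps π := by
  classical
  refine ⟨addMap_mem_maps hπ v, fun E F D hEF hD => ?_⟩
  have : D.1 = E.1 ∪ F.1 := Finset.coe_injective (by rw [Finset.coe_union]; exact hD)
  rw [addMap, this, Finset.sum_union hEF]
  rfl

theorem eq_addMap {ψ : FinSets G → V} (hψ : ψ ∈ additiveMaps π) :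
    ψ = addMap π (ψ (single 1)) := by
  classical
  have hs : ∀ x, ψ (single x) = π x⁻¹ (ψ (single 1)) := fun x => by
    rw [hψ.1.2, gact_single_one]
  have key : ∀ (F : Finset G) (hF : F.Nonempty),
      ψ ⟨F, hF⟩ = ∑ g ∈ F, π g⁻¹ (ψ (single 1)) := by
    intro F hF
    induction hF using Finset.Nonempty.cons_induction with
    | singleton a => rw [Finset.sum_singleton]; exact hs a
    | cons a s ha h ih =>
      rw [Finset.sum_cons, ← ih, ← hs a]
      refine hψ.2 _ _ _ (Finset.disjoint_singleton_left.2 ha) ?_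
      ext x
      simp [single]
  exact funext fun F => key F.1 F.2

/-- The vectors `v` for which `addMap π v` is asymptotically negligible. -/
def nullVectors (π : G →* (V ≃L[ℝ] V)) : Submodule ℝ V where
  carrier := {v | ∀ ε : ℝ, 0 < ε → ∀ᶠ F in invFilter G, ‖addMap π v F‖ ≤ ε * F.1.card}
  zero_mem' ε hε := Eventually.of_forall fun F => by
    have : 0 ≤ ε * (F.1.card : ℝ) := by positivity
    simpa [addMap] using this
  add_mem' {v w} hv hw ε hε := by
    filter_upwards [hv (ε / 2) (half_pos hε), hw (ε / 2) (half_pos hε)] with F h1 h2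
    rw [addMap_add]
    exact (norm_add_le _ _).trans (by linarith)
  smul_mem' c v hv ε hε := by
    filter_upwards [hv (ε / (|c| + 1)) (by positivity)] with F h
    rw [addMap_smul, norm_smul, Real.norm_eq_abs]
    have h1 : |c| * ‖addMap π v F‖ ≤ (|c| + 1) * (ε / (|c| + 1) * F.1.card) :=
      mul_le_mul (by linarith) h (norm_nonneg _) (by positivity)
    refine h1.trans_eq ?_
    field_simp

theorem sub_map_mem_nullVectors (hπ : UniformlyBounded π) (v : V) (h : G) :
    v - π h⁻¹ v ∈ nullVectors π := by
  classical
  obtain ⟨C, hC0, hC⟩ := hπ.exists_bound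
  intro ε hε
  filter_upwards [eventually_card_mul_sdiff_le {h}
    (δ := ε / (2 * (C * ‖v‖ + 1))) (by positivity)] with F hF
  have e : addMap π (π h⁻¹ v) F = ∑ g ∈ h • F.1, π g⁻¹ v := by
    rw [← Finset.image_smul, Finset.sum_image fun x _ y _ hxy => by simpa using hxy]
    refine Finset.sum_congr rfl fun g _ => ?_
    rw [← rep_mul_apply, smul_eq_mul, mul_inv_rev]
  rw [addMap_sub, e, addMap]
  refine (norm_sum_sub_sum_le (fun g => hC g⁻¹ v) F.1 (h • F.1)).trans ?_
  have h1 : ((F.1 ∆ (h • F.1)).card : ℝ) ≤ 2 * (({h} * F.1) \ F.1).card := by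
    rw [symmDiff_comm]
    have := card_mul_symmDiff_le (Finset.singleton_nonempty h) subset_rfl F.1
    rw [Finset.singleton_mul] at this ⊢
    exact_mod_cast this
  have h2 : 0 ≤ C * ‖v‖ := by positivity
  calc ((F.1 ∆ (h • F.1)).card : ℝ) * (C * ‖v‖)
      ≤ 2 * (ε / (2 * (C * ‖v‖ + 1)) * F.1.card) * (C * ‖v‖ + 1) :=
        mul_le_mul (by linarith) (by linarith) h2 (by positivity)
    _ = ε * F.1.card := by field_simp

theorem sub_average_mem_nullVectors (hπ : UniformlyBounded π) (v : V) (F : FinSets G) :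
    v - (F.1.card : ℝ)⁻¹ • addMap π v F ∈ nullVectors π := by
  have hF := (card_pos F).ne'
  have : v - (F.1.card : ℝ)⁻¹ • addMap π v F = (F.1.card : ℝ)⁻¹ • ∑ g ∈ F.1, (v - π g⁻¹ v) := by
    rw [Finset.sum_sub_distrib, smul_sub, Finset.sum_const, ← Nat.cast_smul_eq_nsmul ℝ,
      inv_smul_smul₀ hF]
    rfl
  rw [this]
  exact Submodule.smul_mem _ _ (Submodule.sum_mem _ fun g _ => sub_map_mem_nullVectors hπ v g)

/-- If `addMap π v` approximates `φ` and better approximations exist, then there is one generated by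
a vector close to `v`: the difference to a better one is replaced by its average over an
invariant set, which has a small norm and differs from it by an asymptotically negligible
vector. -/
theorem exists_near_better (hG : IsAmenable G) (hπ : UniformlyBounded π) {φ : FinSets G → V}
    (hφ : ∀ ε : ℝ, 0 < ε → ∃ v, ∀ᶠ F in invFilter G, ‖φ F - addMap π v F‖ ≤ ε * F.1.card)
    {ε : ℝ} (hε : 0 < ε) {v : V}
    (hv : ∀ᶠ F in invFilter G, ‖φ F - addMap π v F‖ ≤ ε * F.1.card) :
    ∃ v', (∀ᶠ F in invFilter G, ‖φ F - addMap π v' F‖ ≤ ε / 2 * F.1.card) ∧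
      ‖v' - v‖ ≤ 2 * ε := by
  have := hG.neBot
  obtain ⟨w, hw⟩ := hφ (ε / 4) (by positivity)
  obtain ⟨F₀, hv₀, hw₀⟩ := (hv.and hw).exists
  have hF₀ := card_pos F₀
  refine ⟨v + (F₀.1.card : ℝ)⁻¹ • addMap π (w - v) F₀, ?_, ?_⟩
  · filter_upwards [hw, sub_average_mem_nullVectors hπ (w - v) F₀ (ε / 4) (by positivity)]
      with F h1 h2
    have : φ F - addMap π (v + (F₀.1.card : ℝ)⁻¹ • addMap π (w - v) F₀) F =
        (φ F - addMap π w F) +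
          addMap π (w - v - (F₀.1.card : ℝ)⁻¹ • addMap π (w - v) F₀) F := by
      simp only [addMap_add, addMap_sub]
      abel
    rw [this]
    exact (norm_add_le _ _).trans (by linarith)
  · rw [add_sub_cancel_left, norm_smul, norm_inv, Real.norm_of_nonneg hF₀.le,
      inv_mul_le_iff₀ hF₀]
    have : addMap π (w - v) F₀ = (φ F₀ - addMap π v F₀) - (φ F₀ - addMap π w F₀) := by
      rw [addMap_sub]
      abel
    rw [this]
    refine (norm_sub_le _ _).trans ?_
    nlinarith

/-- By completeness, an asymptotically additive map is an additive one up to an asymptotically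
negligible error. -/
theorem exists_addMap_sub_negligible [CompleteSpace V] (hG : IsAmenable G)
    (hπ : UniformlyBounded π) {φ : FinSets G → V}
    (hφ : ∀ ε : ℝ, 0 < ε → ∃ v, ∀ᶠ F in invFilter G, ‖φ F - addMap π v F‖ ≤ ε * F.1.card) :
    ∃ v, ∀ ε : ℝ, 0 < ε → ∀ᶠ F in invFilter G, ‖φ F - addMap π v F‖ ≤ ε * F.1.card := by
  obtain ⟨C, hC0, hC⟩ := hπ.exists_bound
  obtain ⟨v₀, hv₀⟩ := hφ 1 one_pos
  have step : ∀ (n : ℕ) (v : V), ∃ v',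
      (∀ᶠ F in invFilter G, ‖φ F - addMap π v F‖ ≤ (1 / 2) ^ n * F.1.card) →
      (∀ᶠ F in invFilter G, ‖φ F - addMap π v' F‖ ≤ (1 / 2) ^ (n + 1) * F.1.card) ∧
        ‖v' - v‖ ≤ 2 * (1 / 2) ^ n := by
    intro n v
    by_cases hv : ∀ᶠ F in invFilter G, ‖φ F - addMap π v F‖ ≤ (1 / 2) ^ n * F.1.card
    · obtain ⟨v', h1, h2⟩ := exists_near_better hG hπ hφ (by positivity) hv
      exact ⟨v', fun _ => ⟨by convert h1 using 4; ring, h2⟩⟩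
    · exact ⟨v, fun h => absurd h hv⟩
  choose f hf using step
  let x : ℕ → V := fun n => Nat.rec v₀ f n
  have hx : ∀ n, ∀ᶠ F in invFilter G, ‖φ F - addMap π (x n) F‖ ≤ (1 / 2) ^ n * F.1.card := by
    intro n
    induction n with
    | zero =>
      change ∀ᶠ F in invFilter G, ‖φ F - addMap π v₀ F‖ ≤ _
      simpa using hv₀
    | succ n ih => exact (hf n (x n) ih).1
  have hdist : ∀ n, dist (x n) (x (n + 1)) ≤ 2 * (1 / 2) ^ n := by
    intro n
    rw [dist_comm, dist_eq_norm]
    exact (hf n (x n) (hx n)).2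
  obtain ⟨v, hv⟩ := cauchySeq_tendsto_of_complete
    (cauchySeq_of_le_geometric (1 / 2) 2 (by norm_num) hdist)
  refine ⟨v, fun ε hε => ?_⟩
  have h1 : ∀ᶠ n in atTop, ((1 : ℝ) / 2) ^ n < ε / 2 :=
    (tendsto_pow_atTop_nhds_zero_of_lt_one (by norm_num) (by norm_num)).eventually
      (gt_mem_nhds (half_pos hε))
  have h2 : ∀ᶠ n in atTop, dist (x n) v < ε / (2 * (C + 1)) :=
    (Metric.tendsto_nhds.1 hv) _ (by positivity)
  obtain ⟨n, hn1, hn2⟩ := (h1.and h2).exists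
  rw [dist_eq_norm, lt_div_iff₀ (by positivity)] at hn2
  filter_upwards [hx n] with F hF
  have e : φ F - addMap π v F = (φ F - addMap π (x n) F) + addMap π (x n - v) F := by
    rw [addMap_sub]
    abel
  rw [e]
  have h3 := norm_addMap_le hC (x n - v) F
  have h4 : (1 / 2) ^ n * (F.1.card : ℝ) ≤ ε / 2 * F.1.card :=
    mul_le_mul_of_nonneg_right hn1.le (card_pos F).le
  have h5 : C * ‖x n - v‖ * F.1.card ≤ ε / 2 * F.1.card :=
    mul_le_mul_of_nonneg_right (by nlinarith [norm_nonneg (x n - v)]) (card_pos F).le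
  exact (norm_add_le _ _).trans (by linarith)

end Norms

/-! ### Asymptotic additivity and almost additivity -/

section MoreInvariant

variable {G : Type u} [Group G] {V : Type v} [SeminormedAddCommGroup V]

/-- The sets that are `(K, δ)`-invariant for all `(K, δ)` for which `E` is. -/
def moreInvariant (E : FinSets G) : Set (FinSets G) :=
  {F | ∀ (K : FinSets G) (δ : ℝ), 0 < δ → IsAlmostInvariant K δ E → IsAlmostInvariant K δ F}

theorem self_mem_moreInvariant (E : FinSets G) : E ∈ moreInvariant E := fun _ _ _ h => h

/-- The supremum of the densities `‖η F‖ / |F|` over the sets `F` that are at least as invariant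
as `E`. -/
noncomputable def domSup (η : FinSets G → V) (E : FinSets G) : ℝ :=
  sSup ((fun F => ‖η F‖ / F.1.card) '' moreInvariant E)

theorem domSup_gact (η : FinSets G → V) (g : G) (E : FinSets G) :
    domSup η (gact g E) = domSup η E := by
  simp only [domSup, moreInvariant, isAlmostInvariant_gact]

theorem domSup_le {η : FinSets G → V} {E : FinSets G} {c : ℝ}
    (h : ∀ F ∈ moreInvariant E, ‖η F‖ ≤ c * F.1.card) : domSup η E ≤ c := by
  refine csSup_le (Set.Nonempty.image _ ⟨E, self_mem_moreInvariant E⟩) ?_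
  rintro _ ⟨F, hF, rfl⟩
  exact (div_le_iff₀ (card_pos F)).2 (h F hF)

theorem domSup_nonneg (η : FinSets G → V) (E : FinSets G) : 0 ≤ domSup η E := by
  refine Real.sSup_nonneg ?_
  rintro _ ⟨F, -, rfl⟩
  positivity

theorem norm_le_domSup {η : FinSets G → V} {B : ℝ} (hη : ∀ F, ‖η F‖ ≤ B * F.1.card)
    {E F : FinSets G} (h : F ∈ moreInvariant E) : ‖η F‖ ≤ domSup η E * F.1.card := by
  rw [← div_le_iff₀ (card_pos F)]
  refine le_csSup ⟨B, ?_⟩ ⟨F, h, rfl⟩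
  rintro _ ⟨F, -, rfl⟩
  exact (div_le_iff₀ (card_pos F)).2 (hη F)

end MoreInvariant

section AlmostAdditive

open Filter

variable {G : Type u} [Group G] {V : Type v} [SeminormedAddCommGroup V] [NormedSpace ℝ V]
  {π : G →* (V ≃L[ℝ] V)}

/-- A map that is additive up to an asymptotically negligible error `η` is almost additive.
The error bound `2 |E| domSup η E` is invariant, and controls `η F` for every set `F` that has `E`
as a piece of a monotone invariant partition. -/
theorem almostAdditive_of_negligible (hπ : UniformlyBounded π) {φ : FinSets G → V}
    (hφ : φ ∈ maps π) {v : V}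
    (hv : ∀ ε : ℝ, 0 < ε → ∀ᶠ F in invFilter G, ‖φ F - addMap π v F‖ ≤ ε * F.1.card) :
    AlmostAdditive π φ := by
  refine ⟨hφ, ?_⟩
  set η : FinSets G → V := fun F => φ F - addMap π v F
  obtain ⟨B, hB, hη⟩ : ∃ B : ℝ, 0 ≤ B ∧ ∀ F, ‖η F‖ ≤ B * F.1.card := by
    obtain ⟨⟨B₁, hB₁, h₁⟩, -⟩ := mem_maps_iff.1 hφ
    obtain ⟨⟨B₂, hB₂, h₂⟩, -⟩ := mem_maps_iff.1 (addMap_mem_maps hπ v)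
    exact ⟨B₁ + B₂, by positivity, fun F => (norm_sub_le _ _).trans (by linarith [h₁ F, h₂ F])⟩
  have hnorm : ∀ F : FinSets G, ‖2 * F.1.card * domSup η F‖ = 2 * domSup η F * F.1.card := by
    intro F
    have := domSup_nonneg η F
    rw [Real.norm_of_nonneg (by positivity)]
    ring
  refine ⟨fun E => 2 * E.1.card * domSup η E, mem_asympKernel_iff.2
    ⟨mem_maps_iff.2 ⟨⟨2 * B, by positivity, fun F => ?_⟩, ?_⟩, fun ε hε => ?_⟩, fun F P hP => ?_⟩
  · rw [hnorm]
    have := domSup_le (η := η) (E := F) (c := B) fun F _ => hη F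
    exact mul_le_mul_of_nonneg_right (by linarith) (card_pos F).le
  · rw [equivariant_one_iff]
    intro g F
    rw [card_gact, domSup_gact]
  · obtain ⟨K, δ, hδ, h⟩ := eventually_invFilter.1 (hv (ε / 2) (half_pos hε))
    refine eventually_invFilter.2 ⟨K, δ, hδ, fun F hF => ?_⟩
    rw [hnorm]
    have := domSup_le (η := η) (E := F) (c := ε / 2) fun F' hF' => h F' (hF' K δ hδ hF)
    exact mul_le_mul_of_nonneg_right (by linarith) (card_pos F).le
  · have e : φ F - ∑ E ∈ P, φ E = η F - ∑ E ∈ P, η E := by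
      simp only [η, Finset.sum_sub_distrib]
      rw [← addMap_eq_sum hP.toIsPartition]
      abel
    have h1 : ‖∑ E ∈ P, η E‖ ≤ ∑ E ∈ P, E.1.card * domSup η E :=
      norm_sum_le_of_le _ fun E _ => by
        rw [mul_comm]
        exact norm_le_domSup hη (self_mem_moreInvariant E)
    have h2 : ‖η F‖ ≤ ∑ E ∈ P, E.1.card * domSup η E := by
      have hF := card_pos F
      have h3 : ‖η F‖ / F.1.card * ∑ E ∈ P, (E.1.card : ℝ) = ‖η F‖ := by
        have : ∑ E ∈ P, (E.1.card : ℝ) = F.1.card := by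
          exact_mod_cast hP.toIsPartition.tiles.sum_card
        rw [this, div_mul_cancel₀ _ hF.ne']
      rw [← h3, Finset.mul_sum]
      refine Finset.sum_le_sum fun E hE => ?_
      rw [mul_comm]
      refine mul_le_mul_of_nonneg_left ((div_le_iff₀ hF).2 ?_) (Nat.cast_nonneg _)
      exact norm_le_domSup hη fun K δ hδ => hP.monotone K δ hδ E hE
    rw [e]
    refine (norm_sub_le _ _).trans ((add_le_add h2 h1).trans_eq ?_)
    rw [← Finset.sum_add_distrib]
    exact Finset.sum_congr rfl fun E _ => by ring

theorem AsymptoticallyAdditive.almostAdditive [CompleteSpace V] (hG : IsAmenable G)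
    (hπ : UniformlyBounded π) {φ : FinSets G → V} (h : AsymptoticallyAdditive π φ) :
    AlmostAdditive π φ := by
  obtain ⟨v, hv⟩ := exists_addMap_sub_negligible hG hπ (φ := φ) fun ε hε => by
    have hlt : (⨅ ψ ∈ additiveMaps π, asympNorm (φ - ψ)) < ENNReal.ofReal ε := by
      rw [h.2]
      exact ENNReal.ofReal_pos.2 hε
    simp only [iInf_lt_iff] at hlt
    obtain ⟨ψ, hψ, hlt⟩ := hlt
    refine ⟨ψ (single 1), ?_⟩
    rw [← eq_addMap hψ]
    exact eventually_le_of_asympNorm_lt hε.le hlt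
  exact almostAdditive_of_negligible hπ h.1 hv

/-- In a finite group the only sufficiently invariant set is the whole group. -/
theorem eventually_eq_univ [Fintype G] : ∀ᶠ F in invFilter G, F.1 = Finset.univ := by
  classical
  have hG : (0 : ℝ) < Fintype.card G := by exact_mod_cast Fintype.card_pos
  filter_upwards [eventually_card_mul_sdiff_le (Finset.univ : Finset G)
    (δ := (2 * (Fintype.card G : ℝ))⁻¹) (by positivity)] with F hF
  have h1 : (F.1.card : ℝ) ≤ Fintype.card G := by exact_mod_cast Finset.card_le_univ F.1
  have h2 : (((Finset.univ * F.1) \ F.1).card : ℝ) < 1 := by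
    refine hF.trans_lt ?_
    rw [inv_mul_lt_iff₀ (by positivity)]
    linarith
  have h3 : (Finset.univ * F.1) \ F.1 = ∅ := by
    rw [← Finset.card_eq_zero]
    exact_mod_cast Nat.lt_one_iff.1 (by exact_mod_cast h2)
  refine Finset.eq_univ_of_forall fun x => ?_
  obtain ⟨y, hy⟩ := F.2
  refine Finset.sdiff_eq_empty_iff_subset.1 h3 ?_
  have := Finset.mul_mem_mul (Finset.mem_univ (x * y⁻¹)) hy
  simpa using this

theorem AlmostAdditive.asymptoticallyAdditive (hG : IsAmenable G) (hπ : UniformlyBounded π)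
    {φ : FinSets G → V} (h : AlmostAdditive π φ) : AsymptoticallyAdditive π φ := by
  obtain ⟨hφ, b, hb, hφb⟩ := h
  refine ⟨hφ, le_antisymm (ENNReal.le_of_forall_pos_le_add fun ε hε _ => ?_) zero_le⟩
  rw [zero_add, ← ENNReal.ofReal_coe_nnreal]
  obtain ⟨F₀, hF₀⟩ : ∃ F₀ : FinSets G, ∀ᶠ F in invFilter G,
      ‖φ F - ∑ g ∈ F.1, (F₀.1.card : ℝ)⁻¹ • φ (gact g⁻¹ F₀)‖ ≤ ε * F.1.card := by
    rcases finite_or_infinite G with hfin | hinf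
    · have := Fintype.ofFinite G
      refine ⟨⟨Finset.univ, Finset.univ_nonempty⟩, eventually_eq_univ.mono fun F hF => ?_⟩
      have h1 : ∀ g : G, gact g ⟨Finset.univ, Finset.univ_nonempty⟩ = F := by
        intro g
        ext x
        simp [mem_gact, hF]
      simp only [h1, Finset.sum_const]
      rw [hF, ← Nat.cast_smul_eq_nsmul ℝ, smul_inv_smul₀, sub_self, norm_zero]
      · positivity
      · exact_mod_cast Fintype.card_ne_zero
    · obtain ⟨hbm, hb0⟩ := mem_asympKernel_iff.1 hb
      obtain ⟨⟨B₁, hB₁, h₁⟩, -⟩ := mem_maps_iff.1 hφ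
      obtain ⟨⟨B₂, hB₂, h₂⟩, -⟩ := mem_maps_iff.1 hbm
      refine exists_eventually_norm_sub_average_le hG (B := max B₁ B₂) (le_max_of_le_left hB₁)
        (fun F => (h₁ F).trans ?_) (fun F => (h₂ F).trans ?_) hb0 hφb hε
      · exact mul_le_mul_of_nonneg_right (le_max_left _ _) (card_pos F).le
      · exact mul_le_mul_of_nonneg_right (le_max_right _ _) (card_pos F).le
  refine (iInf₂_le _ (addMap_mem_additiveMaps hπ ((F₀.1.card : ℝ)⁻¹ • φ F₀))).trans
    (asympNorm_le ε.2 (hF₀.mono fun F hF => ?_))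
  convert hF using 3
  rw [Pi.sub_apply, addMap]
  congr 1
  refine Finset.sum_congr rfl fun g _ => ?_
  rw [map_smul, hφ.2]

/-! ### Riesz-almost additivity -/

theorem RieszAlmostAdditive.almostAdditive [Lattice V] [IsOrderedAddMonoid V]
    (hsolid : ∀ a b : V, |a| ≤ |b| → ‖a‖ ≤ ‖b‖) (hπ : UniformlyBounded π) {φ : FinSets G → V}
    (h : RieszAlmostAdditive π φ) : AlmostAdditive π φ := by
  obtain ⟨hφ, ξ, hξ, hφξ⟩ := h
  obtain ⟨C, hC0, hC⟩ := hπ.exists_bound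
  obtain ⟨hξm, hξ0⟩ := mem_asympKernel_iff.1 hξ
  obtain ⟨⟨B, hB, hξB⟩, hξe⟩ := mem_maps_iff.1 hξm
  have hbd : ∀ g F, ‖ξ (gact g F)‖ ≤ C * ‖ξ F‖ := fun g F => by rw [← hξe]; exact hC _ _
  have hsup : ∀ F, ⨆ g, ‖ξ (gact g F)‖ ≤ C * ‖ξ F‖ := fun F => ciSup_le fun g => hbd g F
  have hnorm : ∀ F, ‖⨆ g, ‖ξ (gact g F)‖‖ ≤ C * ‖ξ F‖ := fun F => by
    rw [Real.norm_of_nonneg (Real.iSup_nonneg fun g => norm_nonneg _)]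
    exact hsup F
  -- The representation need not be isometric, so `‖ξ F‖` itself may fail to be invariant.
  refine ⟨hφ, fun F => ⨆ g, ‖ξ (gact g F)‖, mem_asympKernel_iff.2
    ⟨mem_maps_iff.2 ⟨⟨C * B, by positivity, fun F => ?_⟩, ?_⟩, fun ε hε => ?_⟩, fun F P hP => ?_⟩
  · rw [mul_assoc]
    exact (hnorm F).trans (mul_le_mul_of_nonneg_left (hξB F) hC0)
  · rw [equivariant_one_iff]
    intro h F
    simp only [← gact_mul]
    exact ((Equiv.mulRight h).iSup_comp (g := fun g => ‖ξ (gact g F)‖)).symm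
  · filter_upwards [hξ0 (ε / (C + 1)) (by positivity)] with F hF
    refine (hnorm F).trans ?_
    calc C * ‖ξ F‖ ≤ (C + 1) * (ε / (C + 1) * F.1.card) :=
          mul_le_mul (by linarith) hF (norm_nonneg _) (by positivity)
      _ = ε * F.1.card := by field_simp
  · have h1 := hsolid _ _ ((hφξ F P hP).trans (le_abs_self _))
    refine h1.trans (norm_sum_le_of_le _ fun E _ => ?_)
    have h2 : E = gact 1 E := by
      ext x
      simp [mem_gact]
    refine le_trans (by rw [← h2]) (le_ciSup (f := fun g => ‖ξ (gact g E)‖) ?_ 1)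
    exact ⟨C * ‖ξ E‖, by rintro _ ⟨g, rfl⟩; exact hbd g E⟩

end AlmostAdditive

section BoundedFunctions

variable {G : Type u} [Group G] {X : Type v} [TopologicalSpace X]
  {π : G →* ((X →ᵇ ℝ) ≃L[ℝ] (X →ᵇ ℝ))} {φ : FinSets G → (X →ᵇ ℝ)}

theorem AlmostAdditive.rieszAlmostAdditiveConstType (hπ1 : Unital π) (h : AlmostAdditive π φ) :
    RieszAlmostAdditiveConstType π φ := by
  obtain ⟨hφ, b, hb, hφb⟩ := h
  obtain ⟨hbm, hb0⟩ := mem_asympKernel_iff.1 hb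
  obtain ⟨⟨B, hB, hbB⟩, hbe⟩ := mem_maps_iff.1 hbm
  have hnorm : ∀ F, ‖b F • BoundedContinuousFunction.const X (1 : ℝ)‖ ≤ ‖b F‖ := by
    intro F
    rw [norm_smul]
    refine mul_le_of_le_one_right (norm_nonneg _) ?_
    exact (BoundedContinuousFunction.norm_const_le _).trans_eq norm_one
  refine ⟨hφ, fun F => b F • BoundedContinuousFunction.const X (1 : ℝ), mem_asympKernel_iff.2
    ⟨mem_maps_iff.2 ⟨⟨B, hB, fun F => (hnorm F).trans (hbB F)⟩, fun g F => ?_⟩, fun ε hε => ?_⟩,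
    ⟨b, fun F => rfl⟩, fun F P hP => ?_⟩
  · change π g (b F • _) = b (gact g F) • _
    rw [map_smul, hπ1 g, ← equivariant_one_iff.1 hbe g F]
  · exact (hb0 ε hε).mono fun F hF => (hnorm F).trans hF
  · intro x
    have h1 := ((φ F - ∑ E ∈ P, φ E).norm_coe_le_norm x).trans (hφb F P hP)
    simpa [BoundedContinuousFunction.sum_apply] using h1

theorem RieszAlmostAdditiveConstType.rieszAlmostAdditive (h : RieszAlmostAdditiveConstType π φ) :
    RieszAlmostAdditive π φ := by
  obtain ⟨hφ, ξ, hξ, -, h⟩ := h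
  exact ⟨hφ, ξ, hξ, h⟩

end BoundedFunctions

/-! ### An almost additive map into `L¹[0,1]` that is not Riesz-almost additive -/

section Bump

open Filter MeasureTheory

/-- Lebesgue measure on the unit interval. -/
noncomputable abbrev unitVolume : Measure ℝ := volume.restrict (Set.Icc (0 : ℝ) 1)

/-- The multiple `n (n + 1)` of the indicator function of `(1 / (n + 1), 1 / n]`, which has norm `1`
in `L¹[0,1]` for `n ≥ 1`. -/
noncomputable def bump (n : ℕ) : Lp ℝ 1 unitVolume :=
  indicatorConstLp 1 (measurableSet_Ioc (a := ((n : ℝ) + 1)⁻¹) (b := (n : ℝ)⁻¹))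
    (measure_ne_top _ _) ((n : ℝ) * (n + 1))

theorem norm_bump_le (n : ℕ) : ‖bump n‖ ≤ 1 := by
  rcases n.eq_zero_or_pos with rfl | hn
  · refine norm_indicatorConstLp_le.trans ?_
    simp
  have hn' : (0 : ℝ) < n := by exact_mod_cast hn
  refine norm_indicatorConstLp_le.trans ?_
  have h1 : unitVolume.real (Set.Ioc ((n : ℝ) + 1)⁻¹ (n : ℝ)⁻¹) ≤ (n : ℝ)⁻¹ - ((n : ℝ) + 1)⁻¹ := by
    have h2 : ((n : ℝ) + 1)⁻¹ ≤ (n : ℝ)⁻¹ := inv_anti₀ hn' (by linarith)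
    rw [← Real.volume_real_Ioc_of_le h2]
    exact ENNReal.toReal_mono (by simp) (Measure.restrict_apply_le _ _)
  rw [Real.norm_of_nonneg (by positivity), ENNReal.toReal_one, div_one, Real.rpow_one]
  refine (mul_le_mul_of_nonneg_left h1 (by positivity)).trans_eq ?_
  field_simp
  ring

theorem not_integrable_of_inv_le {u : ℝ → ℝ} (hu : Integrable u unitVolume)
    (h : ∀ n : ℕ, 0 < n → ∀ᵐ x ∂unitVolume, x ∈ Set.Ioc ((n : ℝ) + 1)⁻¹ (n : ℝ)⁻¹ →
      (n : ℝ) + 1 ≤ u x) : False := by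
  have h0 : ∀ᵐ x ∂unitVolume, ∀ n : ℕ, 0 < n → x ∈ Set.Ioc ((n : ℝ) + 1)⁻¹ (n : ℝ)⁻¹ →
      (n : ℝ) + 1 ≤ u x := ae_all_iff.2 fun n => by
    by_cases hn : 0 < n
    · filter_upwards [h n hn] with x hx _ using hx
    · exact Eventually.of_forall fun x h => absurd h hn
  have hle : volume.restrict (Set.Ioc (0 : ℝ) 1) ≤ unitVolume :=
    Measure.restrict_mono Set.Ioc_subset_Icc_self le_rfl
  have hint : IntegrableOn (fun x : ℝ => x⁻¹) (Set.Ioc 0 1) := by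
    refine (hu.mono_measure hle).mono' measurable_inv.aestronglyMeasurable ?_
    filter_upwards [ae_mono hle h0, ae_restrict_mem measurableSet_Ioc] with x hx hx01
    have hx0 : 0 < x := hx01.1
    have h1 : 1 ≤ x⁻¹ := (one_le_inv₀ hx0).2 hx01.2
    rw [Real.norm_of_nonneg (inv_nonneg.2 hx0.le)]
    have h2 : (⌊x⁻¹⌋₊ : ℝ) ≤ x⁻¹ := Nat.floor_le (inv_nonneg.2 hx0.le)
    have h3 : x⁻¹ < ⌊x⁻¹⌋₊ + 1 := Nat.lt_floor_add_one _
    have h4 : 0 < ⌊x⁻¹⌋₊ := Nat.floor_pos.2 h1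
    have h5 : (0 : ℝ) < ⌊x⁻¹⌋₊ := by exact_mod_cast h4
    refine h3.le.trans (hx _ h4 ⟨?_, ?_⟩)
    · exact inv_lt_of_inv_lt₀ hx0 h3
    · exact (le_inv_comm₀ h5 hx0).1 h2
  rw [← intervalIntegrable_iff_integrableOn_Ioc_of_le zero_le_one, intervalIntegrable_inv_iff]
    at hint
  simp at hint

variable {G : Type u} [Group G]

theorem isMonotonePartition_singles (F : FinSets G) : IsMonotonePartition (singles F.1) F := by
  classical
  refine (tiles_singles F.1).isPartition.isMonotonePartition (D := 1) (M := 1) ?_ (by simp)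
    (by simp) ?_ ?_ (by simp)
  · intro E hE
    obtain ⟨x, -, rfl⟩ := mem_singles hE
    exact leftFree_singleton x
  · intro E hE a ha b hb
    obtain ⟨x, -, rfl⟩ := mem_singles hE
    simp only [single, Finset.mem_singleton] at ha hb
    simp [ha, hb]
  · intro E hE
    obtain ⟨x, -, rfl⟩ := mem_singles hE
    exact le_rfl

/-- The map `F ↦ bump |F|` is bounded, hence asymptotically negligible, but its densities are not
dominated by an integrable function. Riesz-almost additivity, applied to the partitions into
points, would provide such a function. -/
theorem exists_almostAdditive_not_rieszAlmostAdditive [Infinite G] :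
    ∃ φ ∈ maps (1 : G →* (Lp ℝ 1 unitVolume ≃L[ℝ] Lp ℝ 1 unitVolume)),
      AlmostAdditive 1 φ ∧ ¬ RieszAlmostAdditive 1 φ := by
  have hπ : UniformlyBounded (1 : G →* (Lp ℝ 1 unitVolume ≃L[ℝ] Lp ℝ 1 unitVolume)) :=
    ⟨‖((1 : Lp ℝ 1 unitVolume ≃L[ℝ] Lp ℝ 1 unitVolume) :
      Lp ℝ 1 unitVolume →L[ℝ] Lp ℝ 1 unitVolume)‖, fun _ => le_rfl⟩
  have hmem : (fun F => bump F.1.card) ∈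
      maps (1 : G →* (Lp ℝ 1 unitVolume ≃L[ℝ] Lp ℝ 1 unitVolume)) := by
    refine mem_maps_iff.2 ⟨⟨1, zero_le_one, fun F => (norm_bump_le _).trans ?_⟩, ?_⟩
    · rw [one_mul]
      exact_mod_cast F.2.card_pos
    · rw [equivariant_one_iff]
      intro g F
      rw [card_gact]
  refine ⟨_, hmem, almostAdditive_of_negligible hπ hmem (v := 0) fun ε hε => ?_, ?_⟩
  · filter_upwards [eventually_le_card ε⁻¹] with F hF
    have h0 : addMap (1 : G →* (Lp ℝ 1 unitVolume ≃L[ℝ] Lp ℝ 1 unitVolume)) 0 F = 0 := by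
      simp [addMap]
    rw [h0, sub_zero]
    exact (norm_bump_le _).trans ((inv_le_iff_one_le_mul₀' hε).1 hF)
  · rintro ⟨-, ξ, hξ, h⟩
    have hξe := equivariant_one_iff.1 hξ.1.2
    refine not_integrable_of_inv_le (L1.integrable_coeFn (bump 1 + ξ (single 1))) fun n hn => ?_
    have hn' : (0 : ℝ) < n := by exact_mod_cast hn
    obtain ⟨A, hA⟩ := Infinite.exists_subset_card_eq G n
    have hAne : A.Nonempty := by
      rw [← Finset.card_pos, hA]
      exact hn
    have h1 := (le_abs_self _).trans (h ⟨A, hAne⟩ _ (isMonotonePartition_singles ⟨A, hAne⟩))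
    simp only [sum_singles] at h1
    have h2 : ∀ x, ξ (single x) = ξ (single 1) := fun x => by
      rw [hξe x⁻¹ (single 1), gact_single_one]
    have h3 : ∀ x : G, (single x).1.card = 1 := fun x => Finset.card_singleton x
    simp only [h2, h3, Finset.sum_const, hA] at h1
    rw [sub_le_iff_le_add', ← nsmul_add, ← Nat.cast_smul_eq_nsmul ℝ, ← Lp.coeFn_le] at h1
    filter_upwards [h1, Lp.coeFn_smul (n : ℝ) (bump 1 + ξ (single 1)),
      indicatorConstLp_coeFn_mem (p := 1) (hs := measurableSet_Ioc) (hμs := measure_ne_top _ _)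
        (μ := unitVolume) (s := Set.Ioc ((n : ℝ) + 1)⁻¹ (n : ℝ)⁻¹) (c := (n : ℝ) * (n + 1))]
      with x hx1 hx2 hx3 hx
    have h5 : (bump n : ℝ → ℝ) x = n * (n + 1) := hx3 hx
    rw [h5] at hx1
    have h4 := hx1.trans_eq hx2
    rw [Pi.smul_apply, smul_eq_mul] at h4
    exact le_of_mul_le_mul_left h4 hn'

end Bump

end SetMap

universe u v w x

theorem theorem1 {G : Type u} [Group G] [Countable G] (hG : SetMap.IsAmenable G) :
    -- complete semi-normed spaces
    (∀ (V : Type v) [SeminormedAddCommGroup V] [NormedSpace ℝ V] [CompleteSpace V]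
        (π : G →* (V ≃L[ℝ] V)), SetMap.UniformlyBounded π →
        ∀ φ ∈ SetMap.maps π,
          (SetMap.AsymptoticallyAdditive π φ → SetMap.AlmostAdditive π φ) ∧
          (Group.ResiduallyFinite G →
            SetMap.AlmostAdditive π φ → SetMap.AsymptoticallyAdditive π φ)) ∧
    -- complete semi-normed Riesz spaces
    (∀ (V : Type w) [SeminormedAddCommGroup V] [NormedSpace ℝ V] [CompleteSpace V]
        [Lattice V] [IsOrderedAddMonoid V] [PosSMulMono ℝ V]
        (_hsolid : ∀ a b : V, |a| ≤ |b| → ‖a‖ ≤ ‖b‖)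
        (π : G →* (V ≃L[ℝ] V)), SetMap.UniformlyBounded π →
        ∀ φ ∈ SetMap.maps π,
          SetMap.RieszAlmostAdditive π φ → SetMap.AlmostAdditive π φ) ∧
    -- the converse fails for the trivial representation on `L¹[0,1]`, for every infinite `G`
    (Infinite G →
      ∃ φ ∈ SetMap.maps (1 : G →*
          (MeasureTheory.Lp ℝ 1 (MeasureTheory.volume.restrict (Set.Icc (0 : ℝ) 1)) ≃L[ℝ]
            MeasureTheory.Lp ℝ 1 (MeasureTheory.volume.restrict (Set.Icc (0 : ℝ) 1)))),
        SetMap.AlmostAdditive 1 φ ∧ ¬ SetMap.RieszAlmostAdditive 1 φ) ∧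
    -- the converse holds for unital representations on the bounded functions on a set `X`
    (∀ (X : Type x) [TopologicalSpace X] [DiscreteTopology X]
        (π : G →* ((BoundedContinuousFunction X ℝ) ≃L[ℝ] (BoundedContinuousFunction X ℝ))),
        SetMap.UniformlyBounded π → SetMap.Unital π →
        ∀ φ ∈ SetMap.maps π,
          (SetMap.AlmostAdditive π φ ↔ SetMap.RieszAlmostAdditiveConstType π φ) ∧
          (SetMap.AlmostAdditive π φ ↔ SetMap.RieszAlmostAdditive π φ)) := by
  refine ⟨fun V _ _ _ π hπ φ _ => ⟨fun h => h.almostAdditive hG hπ,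
      fun _ h => h.asymptoticallyAdditive hG hπ⟩,
    fun V _ _ _ _ _ _ hsolid π hπ φ _ h => h.almostAdditive hsolid hπ,
    fun _ => SetMap.exists_almostAdditive_not_rieszAlmostAdditive,
    fun X _ _ π hπ hπ1 φ _ => ?_⟩
  have hsolid : ∀ a b : BoundedContinuousFunction X ℝ, |a| ≤ |b| → ‖a‖ ≤ ‖b‖ :=
    fun _ _ h => norm_le_norm_of_abs_le_abs h
  exact ⟨⟨fun h => h.rieszAlmostAdditiveConstType hπ1,
      fun h => h.rieszAlmostAdditive.almostAdditive hsolid hπ⟩,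
    ⟨fun h => (h.rieszAlmostAdditiveConstType hπ1).rieszAlmostAdditive,
      fun h => h.almostAdditive hsolid hπ⟩⟩
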